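/- Let $\mathrm{sign}(t)=1$ for $t\ge 0$ and $\mathrm{sign}(t)=-1$ for $t<0$, and let $H_d$ be the class of functions $\mathrm{sign}(f)$ with $f$ a real univariate polynomial of degree at most $d$. A learner for $(\mathbb{R},H_d)$ with derivative queries is given $d\ge 1$, a parameter $\alpha$ and a sample of $n$ distinct points $x_1,\dots,x_n\in\mathbb{R}$ (listed in an arbitrary order), but not the polynomial $f$. It may send batches of queries to an oracle: a query names a sample point $x_j$ and an order $0\le k\le d-1$, and its answer is $\mathrm{sign}(f^{(k)}(x_j))$; all answers to a batch arrive together. The number of queries is the total size of all batches, and the number of rounds is the number of batches. Running time is counted in steps on a randomized real RAM: unit-cost addition, subtraction and comparison of integers, field operations and comparisons of reals (no rounding), indirect addressing, uniform draws from $\{0,\dots,m\}$, placing a query in the current batch, and sending a batch. **Theorem.** There are a randomized real RAM program $A$ and an absolute constant $C$ such that for all integers $d\ge 1$ and $n\ge 2$, all $\alpha\in(1/\log_2 n,\,1]$, all samples $S=\{x_1,\dots,x_n\}\subset\mathbb{R}$ of size $n$ and all polynomials $f$ of degree at most $d$, the program $A$, run on $(S,d,\alpha)$ with the derivative-query oracle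 of $f$, with probability one halts and outputs the correct labels $\mathrm{sign}(f(x_1)),\dots,\mathrm{sign}(f(x_n))$ of all sample points. Moreover, over the internal randomness of $A$, - the expected number of queries is at most $C\,\dfrac{d^3 n^{\alpha}}{\alpha}$; - the expected number of rounds is at most $1+\dfrac{2}{\alpha}$; - the expected running time is at most $C\,n\log_2 n$, and at most $C\,\dfrac{n}{\alpha}$ if the sample is listed in increasing order. -/

import Mathlib

open scoped ENNReal Polynomial

/-! A randomized real RAM with batched oracle queries, presented as a small imperative language
with a small-step (one unit of time per step) semantics.  The memory consists of arrays of natural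
numbers and arrays of real numbers, indexed by program constants and addressed indirectly.
Natural numbers support addition, truncated subtraction and comparison; real numbers support the
field operations and comparison (there is no rounding operation from reals to integers). -/

namespace RealRAM

/-- Natural-number expressions: constants, array cells, sum, truncated difference. -/
inductive NExp : Type
  | lit (c : ℕ) : NExp
  | cell (a : ℕ) (i : NExp) : NExp
  | plus (s t : NExp) : NExp
  | minus (s t : NExp) : NExp

/-- Real expressions: integers, array cells, and the field operations. -/
inductive RExp : Type
  | ofN (e : NExp) : RExp
  | cell (a : ℕ) (i : NExp) : RExp
  | plus (s t : RExp) : RExp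
  | minus (s t : RExp) : RExp
  | times (s t : RExp) : RExp
  | over (s t : RExp) : RExp

/-- Boolean tests. -/
inductive BExp : Type
  | leN (s t : NExp) : BExp
  | leR (s t : RExp) : BExp
  | neg (b : BExp) : BExp
  | conj (b c : BExp) : BExp

/-- Programs.
* `setN a i e`, `setR a i e`: write `e` to cell `i` of the natural / real array `a`.
* `rand a i e`: write a fresh uniformly random element of `{0, …, e}` to cell `i` of the natural
  array `a`.
* `ask a i k j`: add to the current batch the query for the sign of the `k`-th derivative of the
  hidden function at the `j`-th sample point; the answer will go to cell `i` of the natural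
  array `a`.
* `submit`: send the current batch to the oracle and receive all its answers. -/
inductive Cmd : Type
  | skip : Cmd
  | setN (a : ℕ) (i e : NExp) : Cmd
  | setR (a : ℕ) (i : NExp) (e : RExp) : Cmd
  | rand (a : ℕ) (i e : NExp) : Cmd
  | ask (a : ℕ) (i k j : NExp) : Cmd
  | submit : Cmd
  | seq (p q : Cmd) : Cmd
  | ite (b : BExp) (p q : Cmd) : Cmd
  | loop (b : BExp) (p : Cmd) : Cmd

/-- A query waiting in the current batch, with the cell that is to receive its answer. -/
structure Pending where
  arr : ℕ
  idx : ℕ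
  order : ℕ
  point : ℕ

/-- The memory, the current batch, and the three cost counters. -/
structure State where
  nat : ℕ → ℕ → ℕ
  real : ℕ → ℕ → ℝ
  batch : List Pending
  time : ℕ
  queries : ℕ
  rounds : ℕ

noncomputable section

/-- Value of a natural-number expression. -/
def NExp.eval (s : State) : NExp → ℕ
  | .lit c => c
  | .cell a i => s.nat a (i.eval s)
  | .plus e t => e.eval s + t.eval s
  | .minus e t => e.eval s - t.eval s

/-- Value of a real expression. -/
def RExp.eval (s : State) : RExp → ℝ
  | .ofN e => (e.eval s : ℝ)
  | .cell a i => s.real a (i.eval s)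
  | .plus e t => e.eval s + t.eval s
  | .minus e t => e.eval s - t.eval s
  | .times e t => e.eval s * t.eval s
  | .over e t => e.eval s / t.eval s

/-- Truth of a test. -/
def BExp.holds (s : State) : BExp → Prop
  | .leN e t => e.eval s ≤ t.eval s
  | .leR e t => e.eval s ≤ t.eval s
  | .neg b => ¬ b.holds s
  | .conj b c => b.holds s ∧ c.holds s

/-- Write to a cell of a natural-number array. -/
def State.writeN (s : State) (a i v : ℕ) : State :=
  { s with nat := Function.update s.nat a (Function.update (s.nat a) i v) }

/-- Write to a cell of a real array. -/
def State.writeR (s : State) (a i : ℕ) (v : ℝ) : State :=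
  { s with real := Function.update s.real a (Function.update (s.real a) i v) }

/-- Add a query to the current batch. -/
def State.enqueue (s : State) (q : Pending) : State :=
  { s with batch := s.batch ++ [q] }

/-- Send the batch to the oracle `O` (derivative order, index of the sample point ↦ answer):
this is one round, costs as many queries as the batch has entries, and stores all answers. -/
def State.send (O : ℕ → ℕ → ℕ) (s : State) : State :=
  let s' := s.batch.foldl (fun t q => t.writeN q.arr q.idx (O q.order q.point)) s
  { s' with batch := [], queries := s.queries + s.batch.length, rounds := s.rounds + 1 }

/-- One more unit of time. -/
def State.tick (s : State) : State := { s with time := s.time + 1 }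

/-- A configuration: the commands still to be executed, and the state.
The machine has halted when nothing is left to execute. -/
structure Config where
  todo : List Cmd
  state : State

open Classical in
/-- One step of the machine, taking one unit of time.  The oracle `O` is consulted by `submit`
only, and randomness is used by `rand` only; a halted configuration no longer changes. -/
def step (O : ℕ → ℕ → ℕ) (c : Config) : PMF Config :=
  let s := c.state
  match c.todo with
  | [] => PMF.pure c
  | .skip :: k => PMF.pure ⟨k, s.tick⟩
  | .setN a i e :: k => PMF.pure ⟨k, (s.writeN a (i.eval s) (e.eval s)).tick⟩
  | .setR a i e :: k => PMF.pure ⟨k, (s.writeR a (i.eval s) (e.eval s)).tick⟩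
  | .rand a i e :: k =>
      (PMF.uniformOfFintype (Fin (e.eval s + 1))).map fun v =>
        ⟨k, (s.writeN a (i.eval s) v).tick⟩
  | .ask a i r j :: k =>
      PMF.pure ⟨k, (s.enqueue ⟨a, i.eval s, r.eval s, j.eval s⟩).tick⟩
  | .submit :: k => PMF.pure ⟨k, (s.send O).tick⟩
  | .seq p q :: k => PMF.pure ⟨p :: q :: k, s.tick⟩
  | .ite b p q :: k => PMF.pure ⟨(if b.holds s then p else q) :: k, s.tick⟩
  | .loop b p :: k => PMF.pure ⟨if b.holds s then p :: .loop b p :: k else k, s.tick⟩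

/-- The random configuration after `T` steps. -/
def run (O : ℕ → ℕ → ℕ) (c : Config) : ℕ → PMF Config
  | 0 => PMF.pure c
  | T + 1 => (run O c T).bind (step O)

/-- The initial configuration of the program `P` for a learner of degree-`d` polynomial threshold
functions with parameter `α` on the sample `x`: natural array `0` holds `n, d`, real array `0`
holds the sample, cell `0` of real array `1` holds `α`, and every other cell is `0`. -/
def init (P : Cmd) (d : ℕ) (α : ℝ) {n : ℕ} (x : Fin n → ℝ) : Config where
  todo := [P]
  state :=
    { nat := fun a i => if a = 0 ∧ i = 0 then n else if a = 0 ∧ i = 1 then d else 0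
      real := fun a i =>
        if a = 0 then (if h : i < n then x ⟨i, h⟩ else 0) else if a = 1 ∧ i = 0 then α else 0
      batch := []
      time := 0
      queries := 0
      rounds := 0 }

/-- The sign of a real number with the convention `sign 0 = +1`, encoded as a bit:
`1` stands for `+1` and `0` stands for `-1`. -/
def signBit (r : ℝ) : ℕ := open Classical in if 0 ≤ r then 1 else 0

/-- The oracle for derivative queries: it reveals `sign (f^(k) (x_j))` for the sample points `x_j`
and the orders `0 ≤ k ≤ d - 1`.  Any other query gets the uninformative answer `0`. -/
def derivOracle (d : ℕ) {n : ℕ} (x : Fin n → ℝ) (f : ℝ[X]) (k j : ℕ) : ℕ :=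
  if h : k < d ∧ j < n then signBit ((Polynomial.derivative^[k] f).eval (x ⟨j, h.2⟩)) else 0

/-- The random configuration after `T` steps of the learner `P` on the sample `x` against the
hidden polynomial `f`. -/
def learn (P : Cmd) (d : ℕ) (α : ℝ) {n : ℕ} (x : Fin n → ℝ) (f : ℝ[X]) (T : ℕ) : PMF Config :=
  run (derivOracle d x f) (init P d α x) T

/-- With probability one, the learner halts and cells `0, …, n - 1` of natural array `1`
then hold the labels of all `n` sample points. -/
def LabelsPerfectly (P : Cmd) (d : ℕ) (α : ℝ) {n : ℕ} (x : Fin n → ℝ) (f : ℝ[X]) : Prop :=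
  ⨆ T : ℕ, (learn P d α x f T).toOuterMeasure
    {c | c.todo = [] ∧ ∀ j : Fin n, c.state.nat 1 j = signBit (f.eval (x j))} = 1

/-- The expectation of the final value of a (never decreasing) cost counter. -/
def expectedCost (cost : State → ℕ) (P : Cmd) (d : ℕ) (α : ℝ) {n : ℕ} (x : Fin n → ℝ)
    (f : ℝ[X]) : ℝ≥0∞ :=
  ⨆ T : ℕ, ∑' c : Config, learn P d α x f T c * (cost c.state : ℝ≥0∞)

end

end RealRAM

/-!
If all derivatives of order less than `d` have the same signs at two points, then, since the
derivative of order `d` is constant, induction on the order shows that each of them is monotone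
between these points and keeps its sign there.  So equal answers at both ends of an interval reveal
all labels in between.  On the other hand, the derivatives of order less than `d` have together at
most `d ^ 2` roots, each of which spoils at most two intervals of a grid.

The sample is listed in increasing order, and `c = ⌈log₂ n⌉` binary levels lead from a single
interval to intervals of one point.  A round of the search queries all derivatives at both ends of
the unresolved intervals of a grid, and the next round refines this grid by the factor `2 ^ κ`,
where `κ = ⌈α * c⌉`.  So there are `⌈c / κ⌉ ≤ 1 + 1 / α` rounds of `O(n)` steps, each with at most
`2 * d ^ 2 * 2 ^ κ = O(d ^ 2 * n ^ α)` intervals to query.  When `n < d ^ 3 * 2 ^ κ`, querying all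
labels in one batch is cheap enough.
-/

namespace RealRAM

/-! ### Deterministic runs -/

/-- The state `s` with its clock set to `τ`. -/
def State.atTime (s : State) (τ : ℕ) : State := { s with time := τ }

/-- Started in `s`, the command `p` makes no random choice and is executed completely after at
most `t` steps, in a state that satisfies `Q` up to the value of the clock. -/
def TerminatesIn (O : ℕ → ℕ → ℕ) (p : Cmd) (s : State) (t : ℕ) (Q : State → Prop) : Prop :=
  ∃ s' t', t' ≤ t ∧ Q s' ∧
    ∀ k τ, run O ⟨p :: k, s.atTime τ⟩ t' = PMF.pure ⟨k, s'.atTime (τ + t')⟩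

/-- The content of row `a` of the natural memory after the answers to the batch `l` arrived. -/
def answerRow (O : ℕ → ℕ → ℕ) (a : ℕ) (l : List Pending) (r : ℕ → ℕ) : ℕ → ℕ :=
  l.foldl (fun r q => if q.arr = a then Function.update r q.idx (O q.order q.point) else r) r

section Semantics

variable {O : ℕ → ℕ → ℕ} {s : State} {p q : Cmd} {t u : ℕ} {Q R : State → Prop}

theorem run_add (c : Config) (a b : ℕ) :
    run O c (a + b) = (run O c a).bind fun c' => run O c' b := by
  induction b with
  | zero => simp [run]
  | succ b ih => rw [← Nat.add_assoc, run, ih, PMF.bind_bind]; rfl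

theorem run_add_of_pure {c c' : Config} {a : ℕ} (h : run O c a = PMF.pure c') (b : ℕ) :
    run O c (a + b) = run O c' b := by
  rw [run_add, h, PMF.pure_bind]

theorem run_one (c : Config) : run O c 1 = step O c := by
  simp [run]

theorem run_halted (s : State) (T : ℕ) : run O ⟨[], s⟩ T = PMF.pure ⟨[], s⟩ := by
  induction T with
  | zero => rfl
  | succ T ih => rw [run, ih, PMF.pure_bind]; rfl

@[simp] theorem NExp.eval_atTime (e : NExp) (τ : ℕ) : e.eval (s.atTime τ) = e.eval s := by
  induction e with
  | lit c => rfl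
  | cell a i ih => simp only [NExp.eval, ih]; rfl
  | _ a b iha ihb => simp only [NExp.eval, iha, ihb]

@[simp] theorem RExp.eval_atTime (e : RExp) (τ : ℕ) : e.eval (s.atTime τ) = e.eval s := by
  induction e with
  | ofN e => simp only [RExp.eval, NExp.eval_atTime]
  | cell a i => simp only [RExp.eval, NExp.eval_atTime]; rfl
  | _ a b iha ihb => simp only [RExp.eval, iha, ihb]

@[simp] theorem BExp.holds_atTime (b : BExp) (τ : ℕ) :
    b.holds (s.atTime τ) ↔ b.holds s := by
  induction b with
  | neg b ih => simp only [BExp.holds, ih]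
  | conj a b iha ihb => simp only [BExp.holds, iha, ihb]
  | _ a b => simp [BExp.holds]

theorem foldl_answers (l : List Pending) (s : State) :
    l.foldl (fun t q => t.writeN q.arr q.idx (O q.order q.point)) s =
      { s with nat := fun a => answerRow O a l (s.nat a) } := by
  induction l generalizing s with
  | nil => rfl
  | cons q l ih =>
    rw [List.foldl_cons, ih]
    simp only [State.writeN, answerRow, List.foldl_cons, State.mk.injEq, and_true]
    funext a
    by_cases h : q.arr = a
    · subst h; simp
    · simp [h, Function.update_of_ne (Ne.symm h)]

theorem send_eq (s : State) : s.send O =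
    { s with
      nat := fun a => answerRow O a s.batch (s.nat a)
      batch := []
      queries := s.queries + s.batch.length
      rounds := s.rounds + 1 } := by
  simp [State.send, foldl_answers]

theorem send_atTime (s : State) (τ : ℕ) : (s.atTime τ).send O = (s.send O).atTime τ := by
  simp [send_eq, State.atTime]

theorem answerRow_of_forall_arr_ne {a : ℕ} {l : List Pending} (h : ∀ q ∈ l, q.arr ≠ a)
    (r : ℕ → ℕ) : answerRow O a l r = r := by
  induction l generalizing r with
  | nil => rfl
  | cons q l ih =>
    rw [List.forall_mem_cons] at h
    rw [answerRow, List.foldl_cons, if_neg h.1]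
    exact ih h.2 r

theorem answerRow_of_mem {l : List Pending} {q : Pending} (hq : q ∈ l)
    (h : ∀ q' ∈ l, q'.arr = q.arr → q'.idx = q.idx → q' = q) (r : ℕ → ℕ) :
    answerRow O q.arr l r q.idx = O q.order q.point := by
  induction l using List.reverseRecOn generalizing r with
  | nil => simp at hq
  | append_singleton l q₁ ih =>
    simp only [answerRow, List.foldl_append, List.foldl_cons, List.foldl_nil]
    by_cases hq₁ : q₁ = q
    · simp [hq₁]
    · have hl : answerRow O q.arr l r q.idx = O q.order q.point :=
        ih (by simpa [Ne.symm hq₁] using hq) (fun q' hq' => h q' (by simp [hq'])) r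
      split_ifs with harr
      · rw [Function.update_of_ne fun hidx => hq₁ (h q₁ (by simp) harr hidx.symm)]
        exact hl
      · exact hl

theorem TerminatesIn.mono (h : TerminatesIn O p s t Q) (htu : t ≤ u) (hQ : ∀ s, Q s → R s) :
    TerminatesIn O p s u R := by
  obtain ⟨s', t', ht, hs, hr⟩ := h
  exact ⟨s', t', ht.trans htu, hQ _ hs, hr⟩

theorem TerminatesIn.le (h : TerminatesIn O p s t Q) (htu : t ≤ u) : TerminatesIn O p s u Q :=
  h.mono htu fun _ => id

theorem terminatesIn_of_step (s' : State) (hQ : Q s')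
    (h : ∀ k τ, step O ⟨p :: k, s.atTime τ⟩ = PMF.pure ⟨k, s'.atTime (τ + 1)⟩) :
    TerminatesIn O p s 1 Q :=
  ⟨s', 1, le_rfl, hQ, fun k τ => by rw [run_one, h]⟩

theorem terminatesIn_of_step_cons {p' : Cmd} {l : List Cmd}
    (h0 : ∀ k τ, step O ⟨p :: k, s.atTime τ⟩ = PMF.pure ⟨p' :: (l ++ k), s.atTime (τ + 1)⟩)
    (s₁ : State) (t₁ : ℕ)
    (h₁ : ∀ k τ, run O ⟨p' :: k, s.atTime τ⟩ t₁ = PMF.pure ⟨k, s₁.atTime (τ + t₁)⟩)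
    (s₂ : State) (t₂ : ℕ)
    (h₂ : ∀ k τ, run O ⟨l ++ k, s₁.atTime τ⟩ t₂ = PMF.pure ⟨k, s₂.atTime (τ + t₂)⟩)
    (ht : 1 + t₁ + t₂ ≤ t) (hQ : Q s₂) : TerminatesIn O p s t Q := by
  refine ⟨s₂, 1 + t₁ + t₂, ht, hQ, fun k τ => ?_⟩
  rw [Nat.add_assoc, run_add_of_pure (by rw [run_one, h0]), run_add_of_pure (h₁ _ _), h₂,
    Nat.add_assoc, Nat.add_assoc]

theorem terminatesIn_skip (h : Q s) : TerminatesIn O .skip s 1 Q :=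
  terminatesIn_of_step s h fun _ _ => rfl

theorem terminatesIn_setN {a : ℕ} {i e : NExp} (h : Q (s.writeN a (i.eval s) (e.eval s))) :
    TerminatesIn O (.setN a i e) s 1 Q :=
  terminatesIn_of_step _ h fun _ _ => by simp only [step, NExp.eval_atTime]; rfl

theorem terminatesIn_ask {a : ℕ} {i k j : NExp}
    (h : Q (s.enqueue ⟨a, i.eval s, k.eval s, j.eval s⟩)) :
    TerminatesIn O (.ask a i k j) s 1 Q :=
  terminatesIn_of_step _ h fun _ _ => by simp only [step, NExp.eval_atTime]; rfl

theorem terminatesIn_submit (h : Q (s.send O)) : TerminatesIn O .submit s 1 Q :=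
  terminatesIn_of_step _ h fun _ _ => by simp only [step, send_atTime]; rfl

theorem TerminatesIn.seq (h : TerminatesIn O p s t fun s' => TerminatesIn O q s' u Q) :
    TerminatesIn O (.seq p q) s (1 + t + u) Q := by
  obtain ⟨s₁, t₁, ht₁, ⟨s₂, t₂, ht₂, hQ, h₂⟩, h₁⟩ := h
  exact terminatesIn_of_step_cons (l := [q]) (fun _ _ => rfl) s₁ t₁ h₁ s₂ t₂ h₂ (by omega) hQ

theorem TerminatesIn.andThen (h : TerminatesIn O p s t R)
    (h' : ∀ s', R s' → TerminatesIn O q s' u Q) : TerminatesIn O (.seq p q) s (1 + t + u) Q :=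
  .seq (h.mono le_rfl h')

theorem TerminatesIn.ite {b : BExp} (hp : b.holds s → TerminatesIn O p s t Q)
    (hq : ¬ b.holds s → TerminatesIn O q s t Q) : TerminatesIn O (.ite b p q) s (1 + t) Q := by
  classical
  have h : TerminatesIn O (if b.holds s then p else q) s t Q := by
    split_ifs with hb
    exacts [hp hb, hq hb]
  obtain ⟨s', t', ht, hQ, hr⟩ := h
  refine terminatesIn_of_step_cons (l := []) (fun k τ => ?_) s' t' hr s' 0 (fun _ _ => rfl)
    (by omega) hQ
  simp only [step, BExp.holds_atTime]
  congr 2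

theorem TerminatesIn.loop_true {b : BExp} (hb : b.holds s)
    (h : TerminatesIn O p s t fun s' => TerminatesIn O (.loop b p) s' u Q) :
    TerminatesIn O (.loop b p) s (t + 1 + u) Q := by
  obtain ⟨s₁, t₁, ht₁, ⟨s₂, t₂, ht₂, hQ, h₂⟩, h₁⟩ := h
  refine terminatesIn_of_step_cons (l := [.loop b p]) (fun k τ => ?_) s₁ t₁ h₁ s₂ t₂ h₂
    (by omega) hQ
  simp only [step, BExp.holds_atTime, hb, if_true]; rfl

theorem TerminatesIn.loop_false {b : BExp} (hb : ¬ b.holds s) (hQ : Q s) :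
    TerminatesIn O (.loop b p) s 1 Q :=
  terminatesIn_of_step s hQ fun k τ => by
    simp only [step, BExp.holds_atTime, hb, if_false]; rfl

theorem TerminatesIn.loop {b : BExp} (I : ℕ → State → Prop) (N : ℕ) (τ : ℕ → ℕ)
    (h0 : I 0 s) (hb : ∀ i < N, ∀ s, I i s → b.holds s)
    (hbody : ∀ i < N, ∀ s, I i s → TerminatesIn O p s (τ i) (I (i + 1)))
    (hend : ∀ s, I N s → ¬ b.holds s) :
    TerminatesIn O (.loop b p) s (∑ i ∈ Finset.range N, (τ i + 1) + 1) (I N) := by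
  induction N generalizing I s τ with
  | zero => exact .loop_false (hend _ h0) h0
  | succ N ih =>
    have h1 := hbody 0 (by omega) s h0
    refine (TerminatesIn.loop_true (hb 0 (by omega) s h0)
      (h1.mono le_rfl fun s' hs' => ih (fun i => I (i + 1)) (fun i => τ (i + 1)) hs'
        (fun i hi => hb (i + 1) (by omega)) (fun i hi => hbody (i + 1) (by omega)) hend)).le ?_
    rw [Finset.sum_range_succ' _ N]
    omega

theorem TerminatesIn.loop_const {b : BExp} (I : ℕ → State → Prop) (N t : ℕ)
    (h0 : I 0 s) (hb : ∀ i < N, ∀ s, I i s → b.holds s)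
    (hbody : ∀ i < N, ∀ s, I i s → TerminatesIn O p s t (I (i + 1)))
    (hend : ∀ s, I N s → ¬ b.holds s) :
    TerminatesIn O (.loop b p) s (N * (t + 1) + 1) (I N) :=
  (TerminatesIn.loop I N (fun _ => t) h0 hb hbody hend).le (by simp)

end Semantics

/-! ### Expected costs of deterministic runs -/

section Costs

variable {O : ℕ → ℕ → ℕ} {t : ℕ} {Q : State → Prop}

theorem tsum_bind_mul {α β : Type*} (m : PMF α) (κ : α → PMF β) (g : β → ℝ≥0∞) :
    ∑' b, m.bind κ b * g b = ∑' a, m a * ∑' b, κ a b * g b := by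
  simp_rw [PMF.bind_apply, ← ENNReal.tsum_mul_right, ← ENNReal.tsum_mul_left]
  rw [ENNReal.tsum_comm]
  simp_rw [mul_assoc]

theorem le_tsum_mul_of_support {β : Type*} (m : PMF β) (g : β → ℝ≥0∞) (v : ℝ≥0∞)
    (h : ∀ b ∈ m.support, v ≤ g b) : v ≤ ∑' b, m b * g b := by
  calc v = ∑' b, m b * v := by rw [ENNReal.tsum_mul_right, m.tsum_coe, one_mul]
    _ ≤ ∑' b, m b * g b := by
      refine ENNReal.tsum_le_tsum fun b => ?_
      by_cases hb : m b = 0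
      · simp [hb]
      · gcongr; exact h b ((m.mem_support_iff b).2 hb)

theorem tsum_pure_mul {β : Type*} (b : β) (g : β → ℝ≥0∞) :
    ∑' c, PMF.pure b c * g c = g b := by
  classical
  rw [tsum_eq_single b]
  · simp
  · intro c hc; simp [PMF.pure_apply, hc]

/-- A counter that no step of the machine decreases, so that `expectedCost` is the expectation of
its final value. -/
def NeverDecreases (O : ℕ → ℕ → ℕ) (cost : State → ℕ) : Prop :=
  ∀ c, ∀ c' ∈ (step O c).support, cost c.state ≤ cost c'.state

theorem counters_le_of_mem_support_step {c c' : Config} (h : c' ∈ (step O c).support) :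
    c.state.time ≤ c'.state.time ∧ c.state.queries ≤ c'.state.queries ∧
      c.state.rounds ≤ c'.state.rounds := by
  obtain ⟨_ | ⟨p, k⟩, s⟩ := c
  · simp only [step, PMF.support_pure, Set.mem_singleton_iff] at h
    simp [h]
  · cases p
    case rand =>
      simp only [step, PMF.support_map] at h
      obtain ⟨v, -, rfl⟩ := h
      simp [State.tick, State.writeN]
    all_goals
      simp only [step, PMF.support_pure, Set.mem_singleton_iff] at h
      simp [h, State.tick, State.writeN, State.writeR, State.enqueue, send_eq]

theorem neverDecreases_time : NeverDecreases O State.time :=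
  fun _ _ h => (counters_le_of_mem_support_step h).1

theorem neverDecreases_queries : NeverDecreases O State.queries :=
  fun _ _ h => (counters_le_of_mem_support_step h).2.1

theorem neverDecreases_rounds : NeverDecreases O State.rounds :=
  fun _ _ h => (counters_le_of_mem_support_step h).2.2

theorem NeverDecreases.monotone_expectation {cost : State → ℕ} (h : NeverDecreases O cost)
    (c : Config) : Monotone fun T => ∑' c', run O c T c' * (cost c'.state : ℝ≥0∞) := by
  refine monotone_nat_of_le_succ fun T => ?_
  simp only [run, tsum_bind_mul]
  refine ENNReal.tsum_le_tsum fun c' => ?_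
  gcongr
  exact le_tsum_mul_of_support _ _ _ fun b hb => by exact_mod_cast h c' b hb

variable {P : Cmd} {d n : ℕ} {α : ℝ} {x : Fin n → ℝ} {f : ℝ[X]}

theorem TerminatesIn.exists_learn_eq_pure
    (h : TerminatesIn (derivOracle d x f) P (init P d α x).state t Q) :
    ∃ s' t', t' ≤ t ∧ Q s' ∧ ∀ T, learn P d α x f (t' + T) = PMF.pure ⟨[], s'.atTime t'⟩ := by
  obtain ⟨s', t', ht, hQ, hr⟩ := h
  refine ⟨s', t', ht, hQ, fun T => ?_⟩
  have hhalt := hr [] 0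
  rw [Nat.zero_add] at hhalt
  rw [learn, ← run_halted (O := derivOracle d x f) (s'.atTime t') T]
  exact run_add_of_pure hhalt T

theorem TerminatesIn.expectedCost_le {cost : State → ℕ} {B : ℝ}
    (h : TerminatesIn (derivOracle d x f) P (init P d α x).state t Q)
    (hc : NeverDecreases (derivOracle d x f) cost)
    (hB : ∀ s t', t' ≤ t → Q s → cost (s.atTime t') ≤ B) :
    expectedCost cost P d α x f ≤ ENNReal.ofReal B := by
  obtain ⟨s', t', ht, hQ, hr⟩ := h.exists_learn_eq_pure
  refine iSup_le fun T => (hc.monotone_expectation _ (Nat.le_add_left T t')).trans ?_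
  have hT := hr T
  rw [learn] at hT
  simp only [hT, tsum_pure_mul, ← ENNReal.ofReal_natCast]
  exact ENNReal.ofReal_le_ofReal (hB _ _ ht hQ)

theorem TerminatesIn.labelsPerfectly
    (h : TerminatesIn (derivOracle d x f) P (init P d α x).state t Q)
    (hQ : ∀ s, Q s → ∀ j : Fin n, s.nat 1 j = signBit (f.eval (x j))) :
    LabelsPerfectly P d α x f := by
  obtain ⟨s', t', -, hs, hr⟩ := h.exists_learn_eq_pure
  refine le_antisymm (iSup_le fun T => ?_) (le_iSup_of_le (t' + 0) ?_)
  · refine (MeasureTheory.measure_mono (Set.subset_univ _)).trans ?_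
    rw [(PMF.toOuterMeasure_apply_eq_one_iff _ _).2 (Set.subset_univ _)]
  · refine ((PMF.toOuterMeasure_apply_eq_one_iff _ _).2 ?_).ge
    rw [hr, PMF.support_pure, Set.singleton_subset_iff]
    exact ⟨rfl, hQ s' hs⟩

end Costs

/-! ### Straight-line code and counting loops -/

section StraightLine

variable {O : ℕ → ℕ → ℕ} {s s₀ s₁ s₂ : State} {p q : Cmd} {Q : State → Prop} {A B : List ℕ}

/-- Absence of loops, random draws, writes to the real memory and consultations of the oracle. -/
@[simp] def Cmd.Straight : Cmd → Prop
  | .skip | .setN .. | .ask .. => True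
  | .seq p q | .ite _ p q => p.Straight ∧ q.Straight
  | _ => False

/-- The number of nodes of a straight-line command, which bounds its running time. -/
@[simp] def Cmd.size : Cmd → ℕ
  | .seq p q | .ite _ p q => 1 + p.size + q.size
  | _ => 1

open Classical in
/-- The effect of a straight-line command, not counting time. -/
@[simp] noncomputable def Cmd.exec : Cmd → State → State
  | .setN a i e, s => s.writeN a (i.eval s) (e.eval s)
  | .ask a i k j, s => s.enqueue ⟨a, i.eval s, k.eval s, j.eval s⟩
  | .seq p q, s => q.exec (p.exec s)
  | .ite b p q, s => if b.holds s then p.exec s else q.exec s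
  | _, s => s

theorem terminatesIn_straight (hp : p.Straight) (h : Q (p.exec s)) :
    TerminatesIn O p s p.size Q := by
  induction p generalizing s Q with
  | skip => exact terminatesIn_skip h
  | setN => exact terminatesIn_setN h
  | ask => exact terminatesIn_ask h
  | seq p q ihp ihq => exact .seq (ihp hp.1 (ihq hp.2 h))
  | ite b p q ihp ihq =>
    refine (TerminatesIn.ite (t := p.size + q.size) (fun hb => ?_) fun hb => ?_).le
      (by simp only [Cmd.size]; omega)
    · rw [Cmd.exec, if_pos hb] at h
      exact (ihp hp.1 h).le (by omega)
    · rw [Cmd.exec, if_neg hb] at h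
      exact (ihq hp.2 h).le (by omega)
  | _ => exact hp.elim

/-- A scalar variable, which is stored in cell `0` of its own array. -/
abbrev NExp.var (a : ℕ) : NExp := .cell a (.lit 0)

/-- Assignment to a scalar variable. -/
abbrev Cmd.assign (a : ℕ) (e : NExp) : Cmd := .setN a (.lit 0) e

/-- Increment of a scalar variable. -/
abbrev Cmd.incr (a : ℕ) : Cmd := .assign a (.plus (.var a) (.lit 1))

/-- The test `e < e'`. -/
abbrev BExp.lt (e e' : NExp) : BExp := .neg (.leN e' e)

/-- Execute `p` while counting the variable `v` up to `e`. -/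
def Cmd.countTo (v : ℕ) (e : NExp) (p : Cmd) : Cmd := .loop (.lt (.var v) e) (.seq p (.incr v))

theorem writeN_nat_self (s : State) (a i v : ℕ) :
    (s.writeN a i v).nat a = Function.update (s.nat a) i v := by
  simp [State.writeN]

theorem writeN_nat_of_ne (s : State) {a b : ℕ} (i v : ℕ) (h : b ≠ a) :
    (s.writeN a i v).nat b = s.nat b := by
  simp [State.writeN, h]

theorem writeN_nat_apply (s : State) (a i v b j : ℕ) :
    (s.writeN a i v).nat b j = if b = a ∧ j = i then v else s.nat b j := by
  by_cases hb : b = a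
  · subst hb
    simp [writeN_nat_self, Function.update_apply]
  · simp [writeN_nat_of_ne, hb]

@[simp] theorem writeN_real (s : State) (a i v : ℕ) : (s.writeN a i v).real = s.real := rfl

attribute [local simp] NExp.eval RExp.eval BExp.holds writeN_nat_apply

theorem TerminatesIn.countTo {v a b : ℕ} {e : NExp} (I : ℕ → State → Prop) (hp : p.Straight)
    (hab : a ≤ b) (hstart : s.nat v 0 = a) (h0 : I a s) (he : ∀ i s, I i s → e.eval s = b)
    (hbody : ∀ i < b, a ≤ i → ∀ s, s.nat v 0 = i → I i s →
      (p.exec s).nat v 0 = i ∧ I (i + 1) ((p.exec s).writeN v 0 (i + 1))) :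
    TerminatesIn O (.countTo v e p) s ((b - a) * (p.size + 3) + 1) (I b) := by
  refine (TerminatesIn.loop_const (fun j s => s.nat v 0 = a + j ∧ I (a + j) s) (b - a)
    (p.size + 2) ⟨hstart, h0⟩ ?_ ?_ ?_).mono (by simp) fun s hs => ?_
  · rintro j hj s ⟨hv, hI⟩
    simp only [BExp.holds, NExp.eval, hv, he _ s hI]
    omega
  · rintro j hj s ⟨hv, hI⟩
    obtain ⟨hv', hI'⟩ := hbody (a + j) (by omega) (by omega) s hv hI
    refine (terminatesIn_straight (p := p.seq (.incr v)) ⟨hp, trivial⟩ ?_).le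
      (by simp only [Cmd.size]; omega)
    simpa [hv', ← add_assoc] using hI'
  · rintro s ⟨hv, hI⟩
    simp only [BExp.holds, NExp.eval, hv, he _ s hI]
    omega
  · simpa only [Nat.add_sub_cancel' hab] using hs.2

/-- The states `s₀` and `s` differ at most in the clock and in the arrays listed in `A`. -/
structure Agrees (A : List ℕ) (s₀ s : State) : Prop where
  nat : ∀ a ∉ A, s.nat a = s₀.nat a
  real : s.real = s₀.real
  batch : s.batch = s₀.batch
  queries : s.queries = s₀.queries
  rounds : s.rounds = s₀.rounds

theorem Agrees.refl (A : List ℕ) (s : State) : Agrees A s s :=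
  ⟨fun _ _ => rfl, rfl, rfl, rfl, rfl⟩

theorem Agrees.mono (h : Agrees A s₀ s) (hAB : A ⊆ B) : Agrees B s₀ s :=
  ⟨fun a ha => h.nat a fun h => ha (hAB h), h.real, h.batch, h.queries, h.rounds⟩

theorem Agrees.trans (h : Agrees A s₀ s₁) (h' : Agrees A s₁ s₂) : Agrees A s₀ s₂ :=
  ⟨fun a ha => (h'.nat a ha).trans (h.nat a ha), h'.real.trans h.real, h'.batch.trans h.batch,
    h'.queries.trans h.queries, h'.rounds.trans h.rounds⟩

theorem Agrees.writeN (h : Agrees A s₀ s) {a : ℕ} (ha : a ∈ A) (i v : ℕ) :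
    Agrees A s₀ (s.writeN a i v) :=
  ⟨fun b hb => by rw [writeN_nat_of_ne s _ _ (by rintro rfl; exact hb ha), h.nat b hb],
    h.real, h.batch, h.queries, h.rounds⟩

theorem Agrees.append (h : Agrees A s₀ s) (l : List Pending) :
    Agrees A { s₀ with batch := s₀.batch ++ l } { s with batch := s.batch ++ l } :=
  ⟨h.nat, h.real, congrArg (· ++ l) h.batch, h.queries, h.rounds⟩

/-- Straight-line code without queries that writes to the arrays listed in `A` only. -/
@[simp] def Cmd.WritesOnly (A : List ℕ) : Cmd → Prop
  | .skip => True
  | .setN a _ _ => a ∈ A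
  | .seq p q | .ite _ p q => p.WritesOnly A ∧ q.WritesOnly A
  | _ => False

theorem Agrees.exec (h : Agrees A s₀ s) (hp : p.WritesOnly A) : Agrees A s₀ (p.exec s) := by
  induction p generalizing s with
  | skip => exact h
  | setN => exact h.writeN hp _ _
  | seq p q ihp ihq => exact ihq (ihp h hp.1) hp.2
  | ite b p q ihp ihq =>
    rw [Cmd.exec]
    split_ifs
    exacts [ihp h hp.1, ihq h hp.2]
  | _ => exact hp.elim

end StraightLine

/-! ### The program -/

/-! The arrays of natural numbers used by the program; `input` and `labels` are prescribed by the
model, and the registers from `logSize` on are scalar variables.  They are reducible and unfolded by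
`simp` so that distinct registers are seen to be distinct. -/
namespace Reg

@[simp] abbrev input : ℕ := 0
@[simp] abbrev labels : ℕ := 1
@[simp] abbrev leftAnswers : ℕ := 2
@[simp] abbrev rightAnswers : ℕ := 3
@[simp] abbrev order : ℕ := 4
@[simp] abbrev scratch : ℕ := 5
@[simp] abbrev power : ℕ := 6
@[simp] abbrev known : ℕ := 7
@[simp] abbrev logSize : ℕ := 8
@[simp] abbrev stride : ℕ := 9
@[simp] abbrev level : ℕ := 10
@[simp] abbrev width : ℕ := 11
@[simp] abbrev pos : ℕ := 12
@[simp] abbrev base : ℕ := 13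
@[simp] abbrev diffOrder : ℕ := 14
@[simp] abbrev differs : ℕ := 15
@[simp] abbrev cursor : ℕ := 16
@[simp] abbrev unsorted : ℕ := 17
@[simp] abbrev blockStart : ℕ := 18
@[simp] abbrev blockMid : ℕ := 19
@[simp] abbrev blockEnd : ℕ := 20
@[simp] abbrev leftHead : ℕ := 21
@[simp] abbrev rightHead : ℕ := 22
@[simp] abbrev out : ℕ := 23
@[simp] abbrev pass : ℕ := 24

/-- The registers that merging two blocks may change. -/
@[simp] abbrev forMerge : List ℕ :=
  [scratch, blockStart, blockMid, blockEnd, leftHead, rightHead, out]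

/-- The registers that sorting may change. -/
@[simp] abbrev forSort : List ℕ := order :: width :: cursor :: pass :: forMerge

end Reg

open Reg

local infixr:60 " ⨾ " => Cmd.seq

section Program

/-- The sample size. -/
abbrev NExp.sampleSize : NExp := .cell input (.lit 0)

/-- The degree bound. -/
abbrev NExp.degree : NExp := .cell input (.lit 1)

/-- The sample point with a given index. -/
abbrev RExp.point (e : NExp) : RExp := .cell 0 e

/-- The parameter `α`. -/
abbrev RExp.parameter : RExp := .cell 1 (.lit 0)

/-- Tabulate the powers of two up to the first one that is at least the sample size. -/
def powers : Cmd :=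
  .setN power (.lit 0) (.lit 1) ⨾
  .loop (.lt (.cell power (.var logSize)) .sampleSize)
    (.setN power (.plus (.var logSize) (.lit 1))
      (.plus (.cell power (.var logSize)) (.cell power (.var logSize))) ⨾
    .incr logSize)

/-- Compute the logarithm of the branching factor, which is the number of levels by which a round
refines the grid. -/
def exponent : Cmd :=
  .loop (.neg (.leR (.times .parameter (.ofN (.var logSize))) (.ofN (.var stride))))
    (.incr stride)

/-- Query all labels in one batch. -/
def queryAll : Cmd :=
  .countTo cursor .sampleSize (.ask labels (.var cursor) (.lit 0) (.var cursor)) ⨾ .submit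

/-- Initialize the ordering and test whether the sample is increasing. -/
def identity : Cmd :=
  .countTo cursor .sampleSize
    (.setN order (.var cursor) (.var cursor) ⨾
    .ite (.conj (.lt (.plus (.var cursor) (.lit 1)) .sampleSize)
        (.neg (.leR (.point (.var cursor)) (.point (.plus (.var cursor) (.lit 1))))))
      (.assign unsorted (.lit 1)) .skip)

/-- One step of merging two adjacent sorted blocks. -/
def mergeStep : Cmd :=
  .ite (.conj (.lt (.var leftHead) (.var blockMid))
      (.neg (.conj (.lt (.var rightHead) (.var blockEnd))
        (.neg (.leR (.point (.cell order (.var leftHead)))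
          (.point (.cell order (.var rightHead))))))))
    (.setN scratch (.var out) (.cell order (.var leftHead)) ⨾ .incr leftHead)
    (.setN scratch (.var out) (.cell order (.var rightHead)) ⨾ .incr rightHead) ⨾
  .incr out

/-- The minimum of an expression and the sample size. -/
abbrev NExp.cap (e : NExp) : NExp := .minus e (.minus e .sampleSize)

/-- Set the registers of `mergeStep` for the two blocks that start at `blockStart`. -/
def enterBlocks : Cmd :=
  .assign blockMid (.cap (.plus (.var blockStart) (.var width))) ⨾
  .assign blockEnd (.cap (.plus (.var blockStart) (.plus (.var width) (.var width)))) ⨾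
  .assign leftHead (.var blockStart) ⨾
  .assign rightHead (.var blockMid) ⨾
  .assign out (.var blockStart)

/-- Merge the two blocks that start at `blockStart`, and go to the next two. -/
def mergeBlocks : Cmd :=
  enterBlocks ⨾
  .loop (.lt (.var out) (.var blockEnd)) mergeStep ⨾
  .assign blockStart (.plus (.var blockStart) (.plus (.var width) (.var width)))

/-- Copy the merged blocks back. -/
def copyBack : Cmd :=
  .assign cursor (.lit 0) ⨾
  .countTo cursor .sampleSize (.setN order (.var cursor) (.cell scratch (.var cursor)))

/-- Double the width of the sorted blocks. -/
def mergePass : Cmd :=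
  (.assign width (.cell power (.var pass)) ⨾ .assign blockStart (.lit 0)) ⨾
  .loop (.lt (.var blockStart) .sampleSize) mergeBlocks ⨾
  copyBack ⨾
  .incr pass

/-- Bottom-up merge sort. -/
def mergeSort : Cmd := .loop (.lt (.var pass) (.var logSize)) mergePass

/-- Query all derivatives at both ends of an interval. -/
def askInterval : Cmd :=
  .assign diffOrder (.lit 0) ⨾
  .countTo diffOrder .degree
    (.ask leftAnswers (.plus (.var base) (.var diffOrder)) (.var diffOrder)
      (.cell order (.var pos)) ⨾
    .ask rightAnswers (.plus (.var base) (.var diffOrder)) (.var diffOrder)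
      (.cell order (.plus (.var pos) (.var width))))

/-- Execute `p` for all intervals of the current grid that are not resolved.  The register `pos` is
the position of the left end of the interval, and `base` is the index of its first answer. -/
def forIntervals (p : Cmd) : Cmd :=
  (.assign pos (.lit 0) ⨾ .assign base (.lit 0)) ⨾
  .loop (.lt (.var pos) .sampleSize)
    (.ite (.leN (.cell known (.var pos)) (.lit 0)) p .skip ⨾
    .assign pos (.plus (.var pos) (.var width)) ⨾
    .assign base (.plus (.var base) .degree))

/-- Mark and label all positions of an interval. -/
def labelInterval : Cmd :=
  .assign cursor (.var pos) ⨾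
  .countTo cursor (.plus (.var pos) (.var width))
    (.setN known (.var cursor) (.lit 1) ⨾
    .setN labels (.cell order (.var cursor)) (.cell leftAnswers (.var base)))

/-- Compare the answers at both ends of an interval. -/
def compareEnds : Cmd :=
  (.assign diffOrder (.lit 0) ⨾ .assign differs (.lit 0)) ⨾
  .countTo diffOrder .degree
    (.ite (.conj
        (.leN (.cell leftAnswers (.plus (.var base) (.var diffOrder)))
          (.cell rightAnswers (.plus (.var base) (.var diffOrder))))
        (.leN (.cell rightAnswers (.plus (.var base) (.var diffOrder)))
          (.cell leftAnswers (.plus (.var base) (.var diffOrder)))))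
      .skip (.assign differs (.lit 1)))

/-- Label an interval if it consists of one point or the answers at both ends agree. -/
def resolveInterval : Cmd :=
  compareEnds ⨾
  .ite (.neg (.conj (.neg (.leN (.var width) (.lit 1)))
      (.neg (.conj (.leN (.var differs) (.lit 0))
        (.lt (.plus (.var pos) (.var width)) .sampleSize)))))
    labelInterval .skip

/-- Go to the next finer grid. -/
def refineGrid : Cmd :=
  .assign level (.minus (.var level) (.var stride)) ⨾
  .assign width (.cell power (.var level))

/-- One round of the search. -/
def searchRound : Cmd :=
  refineGrid ⨾ (forIntervals askInterval ⨾ .submit) ⨾ forIntervals resolveInterval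

/-- Refine the grid until all labels are known. -/
def search : Cmd :=
  .assign level (.var logSize) ⨾ .loop (.lt (.lit 0) (.var level)) searchRound

/-- List the sample points in increasing order. -/
def sort : Cmd := identity ⨾ .ite (.leN (.lit 1) (.var unsorted)) mergeSort .skip

/-- The test `d ^ 3 * 2 ^ κ ≤ n`, where `κ` is the stride: if it fails, then querying all labels is
cheap enough. -/
def BExp.searchPays : BExp :=
  .leR (.times (.times (.times (.ofN .degree) (.ofN .degree)) (.ofN .degree))
    (.ofN (.cell power (.var stride)))) (.ofN .sampleSize)

/-- The learner, which finds the labels either by search or by querying all of them. -/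
def learner : Cmd := (powers ⨾ exponent) ⨾ .ite .searchPays (sort ⨾ search) queryAll

end Program

/-! ### Preparation and exhaustive queries -/

section Preparation

variable {O : ℕ → ℕ → ℕ} {s s₀ : State} {n : ℕ}

attribute [local simp] NExp.eval RExp.eval BExp.holds writeN_nat_apply

theorem powers_spec (hn : s₀.nat input 0 = n) (h0 : s₀.nat logSize 0 = 0) :
    TerminatesIn O powers s₀ (4 * Nat.clog 2 n + 3) fun s =>
      Agrees [power, logSize] s₀ s ∧ s.nat logSize 0 = Nat.clog 2 n ∧
        ∀ e ≤ Nat.clog 2 n, s.nat power e = 2 ^ e := by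
  refine (TerminatesIn.seq (terminatesIn_straight (by simp)
    (TerminatesIn.loop_const (fun i s => Agrees [power, logSize] s₀ s ∧ s.nat logSize 0 = i ∧
      ∀ e ≤ i, s.nat power e = 2 ^ e) (Nat.clog 2 n) 3 ?_ ?_ ?_ ?_))).le ?_
  · exact ⟨(Agrees.refl _ _).exec (by simp), by simpa, by simp⟩
  · rintro i hi s ⟨hA, h, hp⟩
    have hlt := (Nat.lt_clog_iff_pow_lt (by norm_num)).1 hi
    simpa [hA.nat input (by simp), hn, h, hp i le_rfl] using hlt
  · rintro i - s ⟨hA, h, hp⟩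
    refine terminatesIn_straight (by simp) ⟨hA.exec (by simp), by simpa, fun e he => ?_⟩
    rcases he.lt_or_eq with he | rfl
    · simp [h, he.ne, hp e (by omega)]
    · simp [h, hp i le_rfl, pow_succ, mul_two]
  · rintro s ⟨hA, h, hp⟩
    have hle := Nat.le_pow_clog (b := 2) (by norm_num) n
    simpa [hA.nat input (by simp), hn, h, hp _ le_rfl] using hle
  · simp only [Cmd.size]; omega

theorem exponent_spec (h0 : s₀.nat stride 0 = 0) :
    TerminatesIn O exponent s₀ (2 * ⌈s₀.real 1 0 * s₀.nat logSize 0⌉₊ + 1) fun s =>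
      Agrees [stride] s₀ s ∧ s.nat stride 0 = ⌈s₀.real 1 0 * s₀.nat logSize 0⌉₊ := by
  refine (TerminatesIn.loop_const (fun i s => Agrees [stride] s₀ s ∧ s.nat stride 0 = i) _ 1
    ⟨.refl _ _, h0⟩ ?_ ?_ ?_).le (by omega)
  · rintro i hi s ⟨hA, h⟩
    rw [Nat.lt_ceil] at hi
    simpa [hA.nat logSize (by simp), hA.real, h] using hi
  · rintro i - s ⟨hA, h⟩
    exact terminatesIn_straight (by simp) ⟨hA.exec (by simp), by simpa⟩
  · rintro s ⟨hA, h⟩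
    simpa [hA.nat logSize (by simp), hA.real, h] using Nat.le_ceil _

theorem queryAll_spec (hn : s₀.nat input 0 = n) (h0 : s₀.nat cursor 0 = 0)
    (hb : s₀.batch = []) :
    TerminatesIn O queryAll s₀ (4 * n + 3) fun s =>
      (∀ j < n, s.nat labels j = O 0 j) ∧ s.queries = s₀.queries + n ∧
        s.rounds = s₀.rounds + 1 := by
  let batch (i : ℕ) : List Pending := (List.range i).map fun j => ⟨labels, j, 0, j⟩
  refine (TerminatesIn.andThen (u := 1) (TerminatesIn.countTo
    (fun i s => Agrees [cursor] { s₀ with batch := batch i } s) (by simp) n.zero_le h0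
    ?_ ?_ ?_) fun s hA => terminatesIn_submit ⟨fun j hj => ?_, ?_, ?_⟩).le ?_
  · exact ⟨fun _ _ => rfl, rfl, hb, rfl, rfl⟩
  · intro i s hA
    simp [hA.nat input (by simp), hn]
  · intro i _ _ s hs hA
    refine ⟨by simpa, ?_⟩
    have hA' := (hA.append [⟨labels, i, 0, i⟩]).writeN (a := cursor) (by simp) 0 (i + 1)
    simpa [State.enqueue, batch, List.range_succ, hs] using hA'
  · simp only [Cmd.size]; omega
  · rw [send_eq, hA.batch]
    exact answerRow_of_mem (q := ⟨labels, j, 0, j⟩) (by simpa [batch]) (by simp [batch]) _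
  · simp [send_eq, hA.batch, hA.queries, batch]
  · simp [send_eq, hA.rounds]

theorem identity_spec (hn : s₀.nat input 0 = n) (h0 : s₀.nat cursor 0 = 0)
    (hu : s₀.nat unsorted 0 = 0) :
    TerminatesIn O identity s₀ (8 * n + 1) fun s =>
      Agrees [order, cursor, unsorted] s₀ s ∧ (∀ i < n, s.nat order i = i) ∧
        (s.nat unsorted 0 = 0 ↔ ∀ i, i + 1 < n → s₀.real 0 i ≤ s₀.real 0 (i + 1)) := by
  refine (TerminatesIn.countTo (fun i s => Agrees [order, cursor, unsorted] s₀ s ∧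
    (∀ j < i, s.nat order j = j) ∧
    (s.nat unsorted 0 = 0 ↔ ∀ j < i, j + 1 < n → s₀.real 0 j ≤ s₀.real 0 (j + 1)))
    (by simp) n.zero_le h0 ⟨.refl _ _, by simp, by simpa⟩ ?_ ?_).mono ?_ ?_
  · rintro i s ⟨hA, -⟩
    simp [hA.nat input (by simp), hn]
  · rintro i - - s hs ⟨hA, hid, hsorted⟩
    refine ⟨?_, (hA.exec (by simp)).writeN (by simp) _ _, ?_, ?_⟩
    all_goals simp only [Cmd.exec, BExp.holds, NExp.eval, RExp.eval, writeN_real, hA.real]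
    · split_ifs <;> simpa
    · intro j hj
      rcases Nat.lt_succ_iff_lt_or_eq.1 hj with hj | rfl
      · split_ifs <;> simp [hs, hj.ne, hid j hj]
      · split_ifs <;> simp [hs]
    · rw [Nat.forall_lt_succ_right, ← hsorted]
      by_cases hc : i + 1 < n → s₀.real 0 i ≤ s₀.real 0 (i + 1)
      · rw [if_neg (by simpa [hs, hA.nat input (by simp), hn] using hc)]
        simpa using fun _ => hc
      · rw [if_pos (by simpa [hs, hA.nat input (by simp), hn] using hc)]
        simpa using fun _ => by simpa using hc
  · simp only [Cmd.size]; omega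
  · rintro s ⟨hA, hid, hsorted⟩
    exact ⟨hA, hid, hsorted.trans ⟨fun H i hi => H i (by omega) hi, fun H i _ hi => H i hi⟩⟩

end Preparation

/-! ### Merge sort -/

section Sorting

open Set

variable {O : ℕ → ℕ → ℕ} {s s₀ : State} {X : ℕ → ℝ} {σ τ τ' τ₀ : ℕ → ℕ} {D R R' : Set ℕ}
  {lo mid hi i j t p w n : ℕ}

attribute [local simp] NExp.eval RExp.eval BExp.holds writeN_nat_apply

theorem lt_ceilDiv_iff {i : ℕ} (hw : 0 < w) : i < n ⌈/⌉ w ↔ i * w < n := by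
  rw [← not_le, ceilDiv_le_iff_le_mul hw, not_le, mul_comm]

theorem le_ceilDiv_mul (n : ℕ) (hw : 0 < w) : n ≤ (n ⌈/⌉ w) * w := by
  by_contra! h
  exact lt_irrefl _ ((lt_ceilDiv_iff hw).2 h)

theorem ceilDiv_mul_le (n : ℕ) (hw : 0 < w) : (n ⌈/⌉ w) * w ≤ n + w := by
  rcases Nat.eq_zero_or_pos (n ⌈/⌉ w) with h | h
  · simp [h]
  · obtain ⟨k, hk⟩ := Nat.exists_eq_add_of_lt h
    have := (lt_ceilDiv_iff (i := k) (n := n) hw).1 (by omega)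
    rw [hk, zero_add, add_mul]
    omega

/-- The entries of `τ` from position `lo` to position `t` are the entries of `σ` at the positions in
`D`, listed in increasing order of their values under `X`, and do not exceed the entries of `σ` at
the positions in `R`. -/
structure Merging (X : ℕ → ℝ) (σ τ : ℕ → ℕ) (lo t : ℕ) (D R : Set ℕ) : Prop where
  image : τ '' Ico lo t = σ '' D
  sorted : MonotoneOn (X ∘ τ) (Ico lo t)
  le_remaining : ∀ u ∈ Ico lo t, ∀ p ∈ R, X (τ u) ≤ X (σ p)

theorem Merging.update (h : Merging X σ τ lo t D R) (hlo : lo ≤ t) (hp : p ∈ R)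
    (hmin : ∀ q ∈ R, X (σ p) ≤ X (σ q)) (hR : R' ⊆ R) :
    Merging X σ (Function.update τ t (σ p)) lo (t + 1) (insert p D) R' := by
  have hτ : EqOn (Function.update τ t (σ p)) τ (Ico lo t) := fun u hu =>
    Function.update_of_ne hu.2.ne _ _
  have hIco : Ico lo (t + 1) = insert t (Ico lo t) := by ext; simp; omega
  refine ⟨?_, ?_, ?_⟩
  · rw [hIco, image_insert_eq, image_insert_eq, hτ.image_eq, h.image, Function.update_self]
  · rw [hIco]
    rintro u (rfl | hu) v (rfl | hv) huv
    · rfl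
    · exact absurd hv.2 huv.not_gt
    · simpa [hτ hu] using h.le_remaining u hu p hp
    · simpa [hτ hu, hτ hv] using h.sorted hu hv huv
  · rw [hIco]
    rintro u (rfl | hu) q hq
    · simpa using hmin q (hR hq)
    · simpa [hτ hu] using h.le_remaining u hu q (hR hq)

theorem Merging.takeLeft (h : Merging X σ τ lo t (Ico lo i ∪ Ico mid j) (Ico i mid ∪ Ico j hi))
    (hil : i ∈ Ico lo mid) (hmj : mid ≤ j) (hlo : lo ≤ t)
    (h₁ : MonotoneOn (X ∘ σ) (Ico lo mid)) (h₂ : MonotoneOn (X ∘ σ) (Ico mid hi))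
    (hle : j < hi → X (σ i) ≤ X (σ j)) :
    Merging X σ (Function.update τ t (σ i)) lo (t + 1)
      (Ico lo (i + 1) ∪ Ico mid j) (Ico (i + 1) mid ∪ Ico j hi) := by
  rw [mem_Ico] at hil
  have hdone : Ico lo (i + 1) ∪ Ico mid j = insert i (Ico lo i ∪ Ico mid j) := by
    ext; simp; omega
  rw [hdone]
  refine h.update hlo (by simp; omega) ?_ (by intro; simp; omega)
  rintro q (⟨hiq, hq⟩ | ⟨hjq, hq⟩)
  · exact h₁ ⟨hil.1, hil.2⟩ ⟨by omega, hq⟩ hiq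
  · exact (hle (by omega)).trans (h₂ ⟨hmj, by omega⟩ ⟨by omega, hq⟩ hjq)

theorem Merging.takeRight (h : Merging X σ τ lo t (Ico lo i ∪ Ico mid j) (Ico i mid ∪ Ico j hi))
    (hli : lo ≤ i) (hj : j ∈ Ico mid hi) (hlo : lo ≤ t)
    (h₁ : MonotoneOn (X ∘ σ) (Ico lo mid)) (h₂ : MonotoneOn (X ∘ σ) (Ico mid hi))
    (hle : i < mid → X (σ j) ≤ X (σ i)) :
    Merging X σ (Function.update τ t (σ j)) lo (t + 1)
      (Ico lo i ∪ Ico mid (j + 1)) (Ico i mid ∪ Ico (j + 1) hi) := by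
  rw [mem_Ico] at hj
  have hdone : Ico lo i ∪ Ico mid (j + 1) = insert j (Ico lo i ∪ Ico mid j) := by
    ext; simp; omega
  rw [hdone]
  refine h.update hlo (by simp; omega) ?_ (by intro; simp; omega)
  rintro q (⟨hiq, hq⟩ | ⟨hjq, hq⟩)
  · exact (hle (by omega)).trans (h₁ ⟨hli, by omega⟩ ⟨by omega, hq⟩ hiq)
  · exact h₂ ⟨hj.1, hj.2⟩ ⟨by omega, hq⟩ hjq

/-- The state while the blocks `Ico lo mid` and `Ico mid hi` of `σ` are merged, when their first
entries that are left are at `i` and `j`, and the next entry of the scratch memory to be written is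
at `t`.  The initial entries of the scratch memory are those of `τ₀`. -/
structure MergeState (X : ℕ → ℝ) (σ τ₀ : ℕ → ℕ) (lo mid hi i j t : ℕ) (s : State) : Prop where
  real_eq : s.real 0 = X
  order_eq : s.nat order = σ
  mid_eq : s.nat blockMid 0 = mid
  hi_eq : s.nat blockEnd 0 = hi
  left_eq : s.nat leftHead 0 = i
  right_eq : s.nat rightHead 0 = j
  out_eq : s.nat out 0 = t
  mem_left : i ∈ Icc lo mid
  mem_right : j ∈ Icc mid hi
  count : i + j = mid + t
  kept : EqOn (s.nat scratch) τ₀ (Iio lo)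
  merging : Merging X σ (s.nat scratch) lo t (Ico lo i ∪ Ico mid j) (Ico i mid ∪ Ico j hi)

theorem MergeState.step (h : MergeState X σ τ₀ lo mid hi i j t s) (ht : t < hi)
    (h₁ : MonotoneOn (X ∘ σ) (Ico lo mid)) (h₂ : MonotoneOn (X ∘ σ) (Ico mid hi)) :
    ∃ i' j', MergeState X σ τ₀ lo mid hi i' j' (t + 1) (mergeStep.exec s) := by
  obtain ⟨hreal, horder, hmid, hhi, hleft, hright, hout, hmi, hmj, hcount, hkept, hM⟩ := h
  rw [mem_Icc] at hmi hmj
  have hkept' (v : ℕ) : EqOn (Function.update (s.nat scratch) t v) τ₀ (Iio lo) := fun u hu => by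
    rw [Function.update_of_ne (by rw [mem_Iio] at hu; omega), hkept hu]
  simp only [mergeStep, Cmd.exec, BExp.holds, NExp.eval, RExp.eval, hmid, hhi, hleft, hright,
    horder, hreal, hout]
  split_ifs with hc
  · have hle : j < hi → X (σ i) ≤ X (σ j) := fun hj => by
      by_contra hgt
      exact hc.2 ⟨by omega, hgt⟩
    have hM' := hM.takeLeft ⟨hmi.1, by omega⟩ hmj.1 (by omega) h₁ h₂ hle
    exact ⟨i + 1, j, hreal, by simpa [writeN_nat_of_ne], by simpa, by simpa, by simp [hleft],
      by simpa, by simp [hout], ⟨by omega, by omega⟩, hmj, by omega,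
      by simpa [writeN_nat_self, writeN_nat_of_ne] using hkept' _,
      by simpa [writeN_nat_self, writeN_nat_of_ne] using hM'⟩
  · have hle : i < mid → X (σ j) ≤ X (σ i) := fun hi => by
      by_contra hgt
      exact hc ⟨by omega, fun hj => hj.2 (le_of_not_ge hgt)⟩
    have hM' := hM.takeRight hmi.1 ⟨hmj.1, by omega⟩ (by omega) h₁ h₂ hle
    exact ⟨i, j + 1, hreal, by simpa [writeN_nat_of_ne], by simpa, by simpa, by simpa,
      by simp [hright], by simp [hout], hmi, ⟨by omega, by omega⟩, by omega,
      by simpa [writeN_nat_self, writeN_nat_of_ne] using hkept' _,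
      by simpa [writeN_nat_self, writeN_nat_of_ne] using hM'⟩

theorem mergeLoop_spec (h : MergeState X σ τ₀ lo mid hi lo mid lo s₀) (hlm : lo ≤ mid)
    (hmh : mid ≤ hi) (h₁ : MonotoneOn (X ∘ σ) (Ico lo mid))
    (h₂ : MonotoneOn (X ∘ σ) (Ico mid hi)) :
    TerminatesIn O (.loop (.lt (.var out) (.var blockEnd)) mergeStep) s₀ (10 * (hi - lo) + 1)
      fun s => Agrees [scratch, leftHead, rightHead, out] s₀ s ∧ EqOn (s.nat scratch) τ₀ (Iio lo) ∧
        s.nat scratch '' Ico lo hi = σ '' Ico lo hi ∧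
        MonotoneOn (X ∘ s.nat scratch) (Ico lo hi) := by
  refine (TerminatesIn.loop_const (fun m s => Agrees [scratch, leftHead, rightHead, out] s₀ s ∧
    ∃ i j, MergeState X σ τ₀ lo mid hi i j (lo + m) s) (hi - lo) 9 ?_ ?_ ?_ ?_).mono (by omega) ?_
  · exact ⟨.refl _ _, lo, mid, h⟩
  · rintro m hm s ⟨-, i, j, h⟩
    simp only [BExp.holds, NExp.eval, h.out_eq, h.hi_eq]
    omega
  · rintro m hm s ⟨hA, i, j, h⟩
    exact terminatesIn_straight (by simp [mergeStep])
      ⟨hA.exec (by simp [mergeStep]), h.step (by omega) h₁ h₂⟩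
  · rintro s ⟨-, i, j, h⟩
    simp only [BExp.holds, NExp.eval, h.out_eq, h.hi_eq]
    omega
  · rintro s ⟨hA, i, j, h⟩
    have hil := h.mem_left
    have hjr := h.mem_right
    have hcount := h.count
    rw [mem_Icc] at hil hjr
    obtain rfl : i = mid := by omega
    obtain rfl : j = hi := by omega
    rw [Nat.add_sub_cancel' (hlm.trans hmh)] at h
    refine ⟨hA, h.kept, ?_, h.merging.sorted⟩
    rw [h.merging.image, Ico_union_Ico_eq_Ico hlm hmh]

theorem enterBlocks_exec (hn : s.nat input 0 = n) (hw : s.nat width 0 = w)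
    (hlo : s.nat blockStart 0 = lo) (hlt : lo < n) :
    MergeState (s.real 0) (s.nat order) (s.nat scratch) lo (min (lo + w) n)
      (min (lo + (w + w)) n) lo (min (lo + w) n) lo (enterBlocks.exec s) := by
  have hcap (m : ℕ) : m - (m - n) = min m n := by omega
  refine ⟨rfl, ?_, ?_, ?_, ?_, ?_, ?_, ⟨by omega, by omega⟩, ⟨by omega, by omega⟩, by omega, ?_,
    ⟨?_, ?_, ?_⟩⟩
  all_goals simp [enterBlocks, writeN_nat_of_ne, EqOn, MonotoneOn, hn, hw, hlo, hcap]

theorem mergeBlocks_spec (hn : s₀.nat input 0 = n) (hw : s₀.nat width 0 = w)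
    (hlo : s₀.nat blockStart 0 = lo) (hlt : lo < n)
    (h₁ : MonotoneOn (s₀.real 0 ∘ s₀.nat order) (Ico lo (min (lo + w) n)))
    (h₂ : MonotoneOn (s₀.real 0 ∘ s₀.nat order)
      (Ico (min (lo + w) n) (min (lo + (w + w)) n))) :
    TerminatesIn O mergeBlocks s₀ (20 * w + 13) fun s =>
      Agrees forMerge s₀ s ∧ s.nat blockStart 0 = lo + (w + w) ∧
        EqOn (s.nat scratch) (s₀.nat scratch) (Iio lo) ∧
        s.nat scratch '' Ico lo (min (lo + (w + w)) n) =
          s₀.nat order '' Ico lo (min (lo + (w + w)) n) ∧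
        MonotoneOn (s₀.real 0 ∘ s.nat scratch) (Ico lo (min (lo + (w + w)) n)) := by
  have hA₁ : Agrees forMerge s₀ (enterBlocks.exec s₀) :=
    (Agrees.refl _ _).exec (by simp [enterBlocks])
  have hstart : (enterBlocks.exec s₀).nat blockStart 0 = lo := by simpa [enterBlocks]
  refine (TerminatesIn.seq (terminatesIn_straight (by simp [enterBlocks])
    ((mergeLoop_spec (enterBlocks_exec hn hw hlo hlt) (by omega) (by omega) h₁ h₂).andThen
      fun s ⟨hA, hkept, himage, hsorted⟩ => terminatesIn_straight (by simp) ?_))).le ?_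
  · have hA' := hA₁.trans (hA.mono (by simp))
    refine ⟨hA'.exec (by simp), ?_, ?_, ?_, ?_⟩
    · simp [hA.nat blockStart (by simp), hstart, hA'.nat width (by simp), hw]
    · simpa [writeN_nat_of_ne]
    · simpa [writeN_nat_of_ne]
    · simpa [writeN_nat_of_ne]
  · simp only [enterBlocks, Cmd.size]; omega

/-- Each block of `w` consecutive positions below `n`, starting at a multiple of `w`, is listed by
`τ` in increasing order of the values under `X`. -/
def SortedBlocks (X : ℕ → ℝ) (τ : ℕ → ℕ) (w n : ℕ) : Prop :=
  ∀ b, MonotoneOn (X ∘ τ) (Ico (b * w) (min (b * w + w) n))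

theorem SortedBlocks.extend {b : ℕ} (h : SortedBlocks X τ w (b * w))
    (hτ : EqOn τ' τ (Iio (b * w)))
    (hb : MonotoneOn (X ∘ τ') (Ico (b * w) (min (b * w + w) n))) :
    SortedBlocks X τ' w (min (b * w + w) n) := by
  intro c
  rcases lt_trichotomy c b with hc | rfl | hc
  · have hle : c * w + w ≤ b * w := by
      simpa [add_mul] using Nat.mul_le_mul_right w (Nat.succ_le_of_lt hc)
    have hblock := h c
    rw [min_eq_left hle] at hblock
    exact (hblock.congr fun u hu => congrArg X (hτ (hu.2.trans_le hle)).symm).mono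
      (Ico_subset_Ico_right (min_le_left _ _))
  · simpa using hb
  · have hle : b * w + w ≤ c * w := by
      simpa [add_mul] using Nat.mul_le_mul_right w (Nat.succ_le_of_lt hc)
    rw [Ico_eq_empty (by omega)]
    simp [MonotoneOn]

theorem mergeAll_spec (hn : s₀.nat input 0 = n) (hw : s₀.nat width 0 = w) (hw0 : 0 < w)
    (hstart : s₀.nat blockStart 0 = 0) (hs : SortedBlocks (s₀.real 0) (s₀.nat order) w n) :
    TerminatesIn O (.loop (.lt (.var blockStart) .sampleSize) mergeBlocks) s₀
      ((n ⌈/⌉ (w + w)) * (20 * w + 14) + 1) fun s =>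
      Agrees forMerge s₀ s ∧ s.nat scratch '' Iio n = s₀.nat order '' Iio n ∧
        SortedBlocks (s₀.real 0) (s.nat scratch) (w + w) n := by
  have hW : 0 < w + w := by omega
  refine (TerminatesIn.loop_const (fun b s => Agrees forMerge s₀ s ∧
    s.nat blockStart 0 = b * (w + w) ∧
    s.nat scratch '' Iio (min (b * (w + w)) n) = s₀.nat order '' Iio (min (b * (w + w)) n) ∧
    SortedBlocks (s₀.real 0) (s.nat scratch) (w + w) (min (b * (w + w)) n))
    (n ⌈/⌉ (w + w)) (20 * w + 13) ?_ ?_ ?_ ?_).mono le_rfl ?_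
  · simp [Agrees.refl, hstart, SortedBlocks, MonotoneOn]
  · rintro b hb s ⟨hA, hb', -⟩
    simpa [hA.nat input (by simp), hn, hb'] using (lt_ceilDiv_iff hW).1 hb
  · rintro b hb s ⟨hA, hb', himage, hsorted⟩
    rw [lt_ceilDiv_iff hW] at hb
    rw [min_eq_left hb.le] at himage hsorted
    have horder : s.nat order = s₀.nat order := hA.nat order (by simp)
    have h₁ := hs (2 * b)
    have h₂ := hs (2 * b + 1)
    rw [show 2 * b * w = b * (w + w) by ring] at h₁
    rw [show (2 * b + 1) * w = b * (w + w) + w by ring, add_assoc _ w w] at h₂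
    have h₂' : MonotoneOn (s₀.real 0 ∘ s₀.nat order)
        (Ico (min (b * (w + w) + w) n) (min (b * (w + w) + (w + w)) n)) :=
      h₂.mono fun u hu => by rw [mem_Ico] at hu ⊢; omega
    refine (mergeBlocks_spec (by rw [hA.nat input (by simp), hn])
      (by rw [hA.nat width (by simp), hw]) hb' hb (by rwa [hA.real, horder])
      (by rwa [hA.real, horder])).mono le_rfl ?_
    rintro s' ⟨hA', hb'', hkept, himage', hsorted'⟩
    rw [hA.real, horder] at *
    rw [show (b + 1) * (w + w) = b * (w + w) + (w + w) by ring]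
    refine ⟨hA.trans hA', hb'', ?_, hsorted.extend hkept hsorted'⟩
    rw [← Iio_union_Ico_eq_Iio (show b * (w + w) ≤ min (b * (w + w) + (w + w)) n by omega),
      image_union, image_union, hkept.image_eq, himage, himage']
  · rintro s ⟨hA, hb, -⟩
    simpa [hA.nat input (by simp), hn, hb] using le_ceilDiv_mul n hW
  · rintro s ⟨hA, -, h⟩
    rw [min_eq_right (le_ceilDiv_mul n hW)] at h
    exact ⟨hA, h⟩

theorem copyBack_spec (hn : s₀.nat input 0 = n) :
    TerminatesIn O copyBack s₀ (4 * n + 3) fun s =>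
      Agrees [order, cursor] s₀ s ∧ EqOn (s.nat order) (s₀.nat scratch) (Iio n) := by
  refine (TerminatesIn.seq (terminatesIn_straight (by simp) (TerminatesIn.countTo
    (fun i s => Agrees [order, cursor] s₀ s ∧ EqOn (s.nat order) (s₀.nat scratch) (Iio i))
    (b := n) (by simp) (Nat.zero_le _) (by simp) ?_ ?_ ?_))).le ?_
  · simpa using (Agrees.refl [order, cursor] s₀).writeN (by simp) _ _
  · rintro i s ⟨hA, -⟩
    simp [hA.nat input (by simp), hn]
  · rintro i - - s hs ⟨hA, h⟩
    refine ⟨by simpa, (hA.exec (by simp)).writeN (by simp) _ _, fun u hu => ?_⟩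
    rcases Nat.lt_succ_iff_lt_or_eq.1 hu with hu | rfl
    · simp [hs, hu.ne, h hu]
    · simp [hs, hA.nat scratch (by simp)]
  · simp only [Cmd.size]; omega

theorem mergePass_cost_le (hw : 0 < w) (hwn : w < n) :
    (n ⌈/⌉ (w + w)) * (20 * w + 14) + 4 * n + 11 ≤ 70 * n := by
  have h₁ := ceilDiv_mul_le n (show 0 < w + w by omega)
  have h₂ : n ⌈/⌉ (w + w) ≤ (n ⌈/⌉ (w + w)) * w := Nat.le_mul_of_pos_right _ hw
  nlinarith

theorem mergePass_spec (hn : s₀.nat input 0 = n) (hp : s₀.nat pass 0 = p)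
    (hw : s₀.nat power p = w) (hw0 : 0 < w) (hwn : w < n)
    (hs : SortedBlocks (s₀.real 0) (s₀.nat order) w n) :
    TerminatesIn O mergePass s₀ (70 * n) fun s =>
      Agrees forSort s₀ s ∧ s.nat pass 0 = p + 1 ∧
        s.nat order '' Iio n = s₀.nat order '' Iio n ∧
        SortedBlocks (s₀.real 0) (s.nat order) (w + w) n := by
  refine (TerminatesIn.seq (terminatesIn_straight (by simp) (TerminatesIn.andThen
    (mergeAll_spec (n := n) (w := w) (by simpa) (by simpa [hp]) hw0 (by simp)
      (by simpa [writeN_nat_of_ne])) fun s₁ ⟨hA₁, himage, hsorted⟩ => TerminatesIn.andThen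
    (copyBack_spec (n := n) ?_) fun s₂ ⟨hA₂, hcopy⟩ => terminatesIn_straight (by simp) ?_))).le ?_
  · have := mergePass_cost_le hw0 hwn
    simp only [Cmd.size]
    omega
  · simpa [hA₁.nat input (by simp)]
  · have hA : Agrees forSort s₀ s₂ := (((Agrees.refl _ _).exec (by simp)).trans
      (hA₁.mono (by simp))).trans (hA₂.mono (by simp))
    refine ⟨hA.exec (by simp), ?_, ?_, fun b => ?_⟩
    · simp [hA₂.nat pass (by simp), hA₁.nat pass (by simp), hp]
    · simpa [writeN_nat_of_ne, hcopy.image_eq] using himage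
    · refine (hsorted b).congr fun u hu => ?_
      simp [writeN_nat_of_ne, hcopy (hu.2.trans_le (min_le_right _ _))]

theorem mergeSort_spec (hn : s₀.nat input 0 = n) (hpass : s₀.nat pass 0 = 0)
    (hL : s₀.nat logSize 0 = Nat.clog 2 n) (hpow : ∀ e ≤ Nat.clog 2 n, s₀.nat power e = 2 ^ e) :
    TerminatesIn O mergeSort s₀ (Nat.clog 2 n * (70 * n + 1) + 1) fun s =>
      Agrees forSort s₀ s ∧ s.nat order '' Iio n = s₀.nat order '' Iio n ∧
        MonotoneOn (s₀.real 0 ∘ s.nat order) (Iio n) := by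
  refine (TerminatesIn.loop_const (fun p s => Agrees forSort s₀ s ∧ s.nat pass 0 = p ∧
    s.nat order '' Iio n = s₀.nat order '' Iio n ∧
    SortedBlocks (s₀.real 0) (s.nat order) (2 ^ p) n) (Nat.clog 2 n) (70 * n)
    ⟨.refl _ _, hpass, rfl, fun b => ?_⟩ ?_ ?_ ?_).mono le_rfl ?_
  · intro u hu v hv _
    rw [pow_zero, mem_Ico] at hu hv
    rw [show u = v by omega]
  · rintro p hp s ⟨hA, hp', -⟩
    simpa [hA.nat logSize (by simp), hL, hp'] using hp
  · rintro p hp s ⟨hA, hp', himage, hsorted⟩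
    refine (mergePass_spec (by rw [hA.nat input (by simp), hn]) hp'
      (by rw [hA.nat power (by simp), hpow p hp.le]) (by positivity)
      ((Nat.lt_clog_iff_pow_lt (by norm_num)).1 hp) (by rwa [hA.real])).mono le_rfl ?_
    rintro s' ⟨hA', hp'', himage', hsorted'⟩
    rw [hA.real, ← two_mul, ← pow_succ'] at hsorted'
    exact ⟨hA.trans hA', hp'', himage'.trans himage, hsorted'⟩
  · rintro s ⟨hA, hp, -⟩
    simp [hA.nat logSize (by simp), hL, hp]
  · rintro s ⟨hA, -, himage, hsorted⟩
    refine ⟨hA, himage, (hsorted 0).mono fun u hu => ?_⟩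
    have := Nat.le_pow_clog (b := 2) (by norm_num) n
    simp only [mem_Iio, mem_Ico] at hu ⊢
    omega

theorem sort_spec (hn : s₀.nat input 0 = n) (hcursor : s₀.nat cursor 0 = 0)
    (hunsorted : s₀.nat unsorted 0 = 0) (hpass : s₀.nat pass 0 = 0)
    (hL : s₀.nat logSize 0 = Nat.clog 2 n) (hpow : ∀ e ≤ Nat.clog 2 n, s₀.nat power e = 2 ^ e)
    (ht : 1 ≤ t) (ht' : MonotoneOn (s₀.real 0) (Iio n) ∨ Nat.clog 2 n * (70 * n + 1) < t) :
    TerminatesIn O sort s₀ (8 * n + 3 + t) fun s =>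
      Agrees (unsorted :: forSort) s₀ s ∧ s.nat order '' Iio n = Iio n ∧
        MonotoneOn (s₀.real 0 ∘ s.nat order) (Iio n) := by
  refine ((identity_spec hn hcursor hunsorted).andThen fun s ⟨hA, hid, hs⟩ =>
    TerminatesIn.ite (t := t) (fun hb => ?_) fun hb => ?_).le (by omega)
  all_goals have himage₀ : s.nat order '' Iio n = Iio n := (image_congr hid).trans (image_id' _)
  · have hunsorted' : ¬ MonotoneOn (s₀.real 0) (Iio n) := fun h => by
      simp [hs.2 fun i hi => h (mem_Iio.2 (by omega)) hi i.le_succ] at hb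
    have hmerge := mergeSort_spec (O := O) (by rw [hA.nat input (by simp), hn])
      (by rw [hA.nat pass (by simp), hpass]) (by rw [hA.nat logSize (by simp), hL])
      (by simpa [hA.nat power (by simp)])
    refine hmerge.mono (ht'.resolve_left hunsorted') fun s' ⟨hA', himage, hsorted⟩ =>
      ⟨(hA.mono (by simp)).trans (hA'.mono (by simp)), ?_, by rwa [hA.real] at hsorted⟩
    rw [himage, himage₀]
  · refine (terminatesIn_skip ⟨hA.mono (by simp), ?_, ?_⟩).le ht
    · rw [himage₀]
    · have hmono : MonotoneOn (s₀.real 0) (Iio n) := by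
        refine monotoneOn_of_le_succ ordConnected_Iio fun i _ _ hi => hs.1 ?_ i hi
        simpa using hb
      exact hmono.congr fun i hi => by simp [hid i hi]

end Sorting

/-! ### Inference on a grid -/

section Inference

open Set

variable {O : ℕ → ℕ → ℕ} {n d w r i : ℕ} {σ mark label : ℕ → ℕ}

/-- The points `a` and `b` cannot be distinguished by queries of order less than `d`. -/
def SameAnswers (O : ℕ → ℕ → ℕ) (d a b : ℕ) : Prop := ∀ k < d, O k a = O k b

/-- In the listing `σ` of the points, all points between two indistinguishable ones have the same
label as these. -/
def Inferable (O : ℕ → ℕ → ℕ) (n d : ℕ) (σ : ℕ → ℕ) : Prop :=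
  ∀ a b, a ≤ b → b < n → SameAnswers O d (σ a) (σ b) → ∀ p ∈ Icc a b, O 0 (σ p) = O 0 (σ a)

open Classical in
/-- In every grid, the ends of all but at most `2 * d ^ 2` intervals are indistinguishable. -/
def FewChanges (O : ℕ → ℕ → ℕ) (n d : ℕ) (σ : ℕ → ℕ) : Prop :=
  ∀ w, ((Finset.range n).filter fun q =>
    q * w + w < n ∧ ¬ SameAnswers O d (σ (q * w)) (σ (q * w + w))).card ≤ 2 * d ^ 2

/-- The labels in the `q`-th interval of the grid of width `w` can be inferred from the answers to
all queries at its ends. -/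
def Decided (O : ℕ → ℕ → ℕ) (n d : ℕ) (σ : ℕ → ℕ) (w q : ℕ) : Prop :=
  w ≤ 1 ∨ (q * w + w < n ∧ SameAnswers O d (σ (q * w)) (σ (q * w + w)))

/-- The first `i` intervals of the grid of width `w` have been treated: all decided positions among
them are marked by a nonzero value of `mark`, marked positions are labelled correctly, and
intervals are marked as a whole. -/
structure Searched (O : ℕ → ℕ → ℕ) (n d : ℕ) (σ : ℕ → ℕ) (w i : ℕ) (mark label : ℕ → ℕ) :
    Prop where
  correct : ∀ p < n, mark p ≠ 0 → label (σ p) = O 0 (σ p)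
  undecided : ∀ p < n, p / w < i → mark p = 0 → ¬ Decided O n d σ w (p / w)
  const : ∀ p < n, mark p = mark (p / w * w)

/-- The indices of the intervals among the first `m` whose left end is not marked. -/
def unknownIntervals (mark : ℕ → ℕ) (w m : ℕ) : List ℕ :=
  (List.range m).filter fun i => mark (i * w) = 0

theorem mem_Ico_mul_iff {p : ℕ} (hw : 0 < w) : p ∈ Ico (i * w) (i * w + w) ↔ p / w = i := by
  rw [mem_Ico, ← Nat.succ_mul, ← Nat.le_div_iff_mul_le hw, ← Nat.div_lt_iff_lt_mul hw]
  omega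

theorem Decided.label_eq (h : Decided O n d σ w i) (hinf : Inferable O n d σ) {p : ℕ}
    (hp : p ∈ Ico (i * w) (i * w + w)) : O 0 (σ p) = O 0 (σ (i * w)) := by
  rcases h with hw | ⟨hn, hsame⟩
  · rw [mem_Ico] at hp
    rw [show p = i * w by omega]
  · exact hinf _ _ (by omega) hn hsame p ⟨hp.1, hp.2.le⟩

theorem Searched.succ (h : Searched O n d σ w i mark label)
    (hi : mark (i * w) = 0 → ¬ Decided O n d σ w i) :
    Searched O n d σ w (i + 1) mark label := by
  refine ⟨h.correct, fun p hp hpi hk => ?_, h.const⟩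
  rcases Nat.lt_succ_iff_lt_or_eq.1 hpi with hpi | rfl
  · exact h.undecided p hp hpi hk
  · exact hi (h.const p hp ▸ hk)

open Classical in
theorem Searched.mark_interval (h : Searched O n d σ w i mark label) (hw : 0 < w)
    (hinf : Inferable O n d σ) (hi : Decided O n d σ w i) :
    Searched O n d σ w (i + 1)
      ((Ico (i * w) (i * w + w)).piecewise (fun _ => 1) mark)
      ((σ '' Ico (i * w) (i * w + w)).piecewise (fun _ => O 0 (σ (i * w))) label) := by
  refine ⟨fun p hp hk => ?_, fun p hp hpi hk => ?_, fun p hp => ?_⟩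
  · by_cases hσ : σ p ∈ σ '' Ico (i * w) (i * w + w)
    · obtain ⟨q, hq, hqp⟩ := hσ
      rw [← hqp, piecewise_eq_of_mem _ _ _ (mem_image_of_mem σ hq), hi.label_eq hinf hq]
    · rw [piecewise_eq_of_notMem _ _ _ fun hblock => hσ (mem_image_of_mem σ hblock)] at hk
      rw [piecewise_eq_of_notMem _ _ _ hσ, h.correct p hp hk]
  · by_cases hblock : p ∈ Ico (i * w) (i * w + w)
    · simp [piecewise_eq_of_mem _ _ _ hblock] at hk
    · rw [piecewise_eq_of_notMem _ _ _ hblock] at hk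
      rw [mem_Ico_mul_iff hw] at hblock
      exact h.undecided p hp (by omega) hk
  · simp only [piecewise, mem_Ico_mul_iff hw, Nat.mul_div_cancel _ hw, ← h.const p hp]

theorem Searched.refine (h : Searched O n d σ (r * w) i mark label) (hw : 0 < w) :
    Searched O n d σ w 0 mark label := by
  refine ⟨h.correct, by simp, fun p hp => ?_⟩
  have hle := Nat.div_mul_le_self p w
  rw [h.const p hp, h.const _ (hle.trans_lt hp), Nat.mul_div_mul_right _ _ hw,
    Nat.div_div_eq_div_mul, Nat.mul_comm w r]

theorem searched_zero (hw : 1 < w) (hn : n ≤ w) :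
    Searched O n d σ w i (fun _ => 0) label := by
  refine ⟨by simp, fun p _ _ _ hdecided => ?_, by simp⟩
  rcases hdecided with hw' | ⟨hn', -⟩ <;> omega

theorem Searched.label_eq (h : Searched O n d σ 1 n mark label) {p : ℕ} (hp : p < n) :
    label (σ p) = O 0 (σ p) :=
  h.correct p hp fun hk => h.undecided p hp (by simpa) hk (.inl le_rfl)

open Classical in
theorem card_undecided_le (hfew : FewChanges O n d σ) (hw : 0 < w) :
    ((Finset.range (n ⌈/⌉ w)).filter fun q => ¬ Decided O n d σ w q).card ≤ 2 * d ^ 2 + 1 := by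
  let last := (Finset.range (n ⌈/⌉ w)).filter fun q => n ≤ q * w + w
  have hlast : last.card ≤ 1 := by
    refine Finset.card_le_one.2 fun a ha b hb => ?_
    simp only [last, Finset.mem_filter, Finset.mem_range, lt_ceilDiv_iff hw, ← Nat.succ_mul]
      at ha hb
    have hab := lt_of_mul_lt_mul_right (ha.1.trans_le hb.2) w.zero_le
    have hba := lt_of_mul_lt_mul_right (hb.1.trans_le ha.2) w.zero_le
    omega
  refine (Finset.card_le_card fun q hq => ?_).trans
    ((Finset.card_union_le _ last).trans (add_le_add (hfew w) hlast))
  simp only [last, Decided, not_or, not_and, Finset.mem_filter, Finset.mem_range,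
    Finset.mem_union, lt_ceilDiv_iff hw] at hq ⊢
  by_cases hn : q * w + w < n
  · exact .inl ⟨by nlinarith, hn, hq.2.2 hn⟩
  · exact .inr ⟨hq.1, by omega⟩

theorem Searched.length_unknownIntervals_le
    (h : Searched O n d σ (r * w) (n ⌈/⌉ (r * w)) mark label)
    (hfew : FewChanges O n d σ) (hr : 0 < r) (hw : 0 < w) :
    (unknownIntervals mark w (n ⌈/⌉ w)).length ≤ r * (2 * d ^ 2 + 1) := by
  classical
  rw [unknownIntervals, ← List.countP_eq_length_filter, ← Nat.count,
    Nat.count_eq_card_filter_range]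
  have hmaps : ∀ i ∈ (Finset.range (n ⌈/⌉ w)).filter (fun i => mark (i * w) = 0),
      i / r ∈ (Finset.range (n ⌈/⌉ (r * w))).filter fun q => ¬ Decided O n d σ (r * w) q := by
    intro i hi
    rw [Finset.mem_filter, Finset.mem_range, lt_ceilDiv_iff hw] at hi
    have hlt : i / r < n ⌈/⌉ (r * w) := by
      rw [lt_ceilDiv_iff (by positivity), ← mul_assoc]
      exact (Nat.mul_le_mul_right w (Nat.div_mul_le_self i r)).trans_lt hi.1
    have hdiv := Nat.mul_div_mul_right i r hw
    rw [Finset.mem_filter, Finset.mem_range]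
    exact ⟨hlt, hdiv ▸ h.undecided _ hi.1 (hdiv ▸ hlt) hi.2⟩
  refine (Finset.card_le_mul_card_image_of_maps_to hmaps r fun q _ => ?_).trans
    (Nat.mul_le_mul_left r (card_undecided_le hfew (by positivity)))
  calc _ ≤ (Finset.Ico (q * r) (q * r + r)).card := Finset.card_le_card fun i hi => by
        rw [← Finset.mem_coe, Finset.coe_Ico, mem_Ico_mul_iff hr]
        exact (Finset.mem_filter.1 hi).2
    _ = r := by simp

end Inference

/-! ### Search -/

section Search

open Set

variable {O : ℕ → ℕ → ℕ} {s s₀ : State} {n d w i t : ℕ} {σ : ℕ → ℕ} {A : List ℕ} {p : Cmd}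

attribute [local simp] NExp.eval RExp.eval BExp.holds writeN_nat_apply

/-- The registers describe the grid of width `w` on `n` points listed in the order `σ`, to be
searched with queries of order less than `d`. -/
structure Grid (n d : ℕ) (σ : ℕ → ℕ) (w : ℕ) (s : State) : Prop where
  size : s.nat input 0 = n
  degree : s.nat input 1 = d
  order : s.nat order = σ
  width : s.nat width 0 = w

theorem Grid.agrees (h : Grid n d σ w s₀) (hs : Agrees A s₀ s)
    (hA : ∀ a ∈ [input, Reg.order, Reg.width], a ∉ A) : Grid n d σ w s := by
  simp only [List.forall_mem_cons] at hA
  exact ⟨by rw [hs.nat _ hA.1, h.size], by rw [hs.nat _ hA.1, h.degree],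
    by rw [hs.nat _ hA.2.1, h.order], by rw [hs.nat _ hA.2.2.1, h.width]⟩

/-- The queries of all derivatives at both ends of the `i`-th interval of the grid of width `w`. -/
def questions (d : ℕ) (σ : ℕ → ℕ) (w i : ℕ) : List Pending :=
  (List.range d).flatMap fun k =>
    [⟨leftAnswers, i * d + k, k, σ (i * w)⟩, ⟨rightAnswers, i * d + k, k, σ (i * w + w)⟩]

/-- The rows `l` and `r` hold the answers to `questions d σ w i`. -/
def Answered (O : ℕ → ℕ → ℕ) (d : ℕ) (σ : ℕ → ℕ) (w : ℕ) (l r : ℕ → ℕ) (i : ℕ) : Prop :=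
  ∀ k < d, l (i * d + k) = O k (σ (i * w)) ∧ r (i * d + k) = O k (σ (i * w + w))

theorem mem_questions {q : Pending} : q ∈ questions d σ w i ↔ ∃ k < d,
    q = ⟨leftAnswers, i * d + k, k, σ (i * w)⟩ ∨
      q = ⟨rightAnswers, i * d + k, k, σ (i * w + w)⟩ := by
  simp [questions]

theorem length_flatMap_questions (l : List ℕ) :
    (l.flatMap (questions d σ w)).length = l.length * (d * 2) := by
  simp [List.length_flatMap, questions]

theorem eq_of_mem_questions {i' : ℕ} {q q' : Pending} (hq : q ∈ questions d σ w i)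
    (hq' : q' ∈ questions d σ w i') (harr : q'.arr = q.arr) (hidx : q'.idx = q.idx) : q' = q := by
  rw [mem_questions] at hq hq'
  obtain ⟨k, hk, hq⟩ := hq
  obtain ⟨k', hk', hq'⟩ := hq'
  have hindex : i' * d + k' = i * d + k := by
    rcases hq with rfl | rfl <;> rcases hq' with rfl | rfl <;> exact hidx
  have hkk : k' = k := by
    simpa [Nat.mod_eq_of_lt, hk, hk'] using congrArg (· % d) hindex
  have hii : i' = i := Nat.eq_of_mul_eq_mul_right (k.zero_le.trans_lt hk) (by omega)
  subst hkk hii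
  rcases hq with rfl | rfl <;> rcases hq' with rfl | rfl <;> simp at harr ⊢

theorem answered_of_batch {l : List ℕ} (hi : i ∈ l) (r r' : ℕ → ℕ) :
    Answered O d σ w (answerRow O leftAnswers (l.flatMap (questions d σ w)) r)
      (answerRow O rightAnswers (l.flatMap (questions d σ w)) r') i := by
  have hanswer : ∀ q ∈ questions d σ w i, ∀ r,
      answerRow O q.arr (l.flatMap (questions d σ w)) r q.idx = O q.order q.point := by
    refine fun q hq => answerRow_of_mem (List.mem_flatMap.2 ⟨i, hi, hq⟩) fun q' hq' => ?_
    obtain ⟨i', -, hq'⟩ := List.mem_flatMap.1 hq'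
    exact eq_of_mem_questions hq hq'
  exact fun k hk => ⟨hanswer _ (mem_questions.2 ⟨k, hk, .inl rfl⟩) r,
    hanswer _ (mem_questions.2 ⟨k, hk, .inr rfl⟩) r'⟩

theorem askInterval_spec (h : Grid n d σ w s₀) (hpos : s₀.nat pos 0 = i * w)
    (hbase : s₀.nat base 0 = i * d) :
    TerminatesIn O askInterval s₀ (6 * d + 3)
      (Agrees [diffOrder] { s₀ with batch := s₀.batch ++ questions d σ w i }) := by
  let pair (k : ℕ) : List Pending :=
    [⟨leftAnswers, i * d + k, k, σ (i * w)⟩, ⟨rightAnswers, i * d + k, k, σ (i * w + w)⟩]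
  refine (TerminatesIn.seq (terminatesIn_setN (TerminatesIn.countTo
    (fun k s => Agrees [diffOrder]
      { s₀ with batch := s₀.batch ++ (List.range k).flatMap pair } s)
    (by simp) d.zero_le (by simp) ?_ ?_ ?_))).le (by simp only [Cmd.size]; omega)
  · simpa using (Agrees.refl [diffOrder] s₀).writeN (by simp) _ _
  · intro k s hA
    simp [hA.nat input (by simp), h.degree]
  · intro k _ _ s hs hA
    refine ⟨by simpa, ?_⟩
    have hA' := (hA.append (pair k)).writeN (a := diffOrder) (by simp) 0 (k + 1)
    simpa [State.enqueue, pair, List.range_succ, hs, hA.nat pos (by simp), hpos,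
      hA.nat base (by simp), hbase, hA.nat width (by simp), h.width, hA.nat order (by simp),
      h.order] using hA'

theorem forIntervals_spec (hw : 0 < w) (I : ℕ → State → Prop) (active : ℕ → Prop)
    [DecidablePred active] (h0 : I 0 s₀)
    (hI : ∀ a ∈ [pos, base], ∀ v i s, I i s → I i (s.writeN a 0 v))
    (hgrid : ∀ i s, I i s → Grid n d σ w s)
    (hactive : ∀ i < n ⌈/⌉ w, ∀ s, I i s → (s.nat known (i * w) = 0 ↔ active i))
    (hbody : ∀ i < n ⌈/⌉ w, active i → ∀ s, I i s → s.nat pos 0 = i * w → s.nat base 0 = i * d →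
      TerminatesIn O p s t fun s' =>
        I (i + 1) s' ∧ s'.nat pos 0 = i * w ∧ s'.nat base 0 = i * d)
    (hskip : ∀ i < n ⌈/⌉ w, ¬ active i → ∀ s, I i s → I (i + 1) s) :
    TerminatesIn O (forIntervals p) s₀
      (7 * (n ⌈/⌉ w) + ((List.range (n ⌈/⌉ w)).filter active).length * t + 5) (I (n ⌈/⌉ w)) := by
  refine (TerminatesIn.seq (terminatesIn_straight (by simp) (TerminatesIn.loop
    (fun i s => I i s ∧ s.nat pos 0 = i * w ∧ s.nat base 0 = i * d) (n ⌈/⌉ w)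
    (fun i => 6 + if active i then t else 0) ?_ ?_ ?_ ?_))).mono ?_ fun s hs => hs.1
  · exact ⟨hI base (by simp) _ _ _ (hI pos (by simp) _ _ _ h0), by simp⟩
  · rintro i hi s ⟨hs, hpos, -⟩
    simpa [hpos, (hgrid i s hs).size] using (lt_ceilDiv_iff hw).1 hi
  · rintro i hi s ⟨hs, hpos, hbase⟩
    have hstep : TerminatesIn O (.ite (.leN (.cell known (.var pos)) (.lit 0)) p .skip) s
        (2 + if active i then t else 0)
        fun s' => I (i + 1) s' ∧ s'.nat pos 0 = i * w ∧ s'.nat base 0 = i * d := by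
      refine (TerminatesIn.ite (t := 1 + if active i then t else 0) (fun hb => ?_)
        fun hb => ?_).le (by omega)
      all_goals simp only [BExp.holds, NExp.eval, hpos, Nat.le_zero, hactive i hi s hs] at hb
      · exact (hbody i hi hb s hs hpos hbase).le (by simp [hb])
      · exact (terminatesIn_skip ⟨hskip i hi hb s hs, hpos, hbase⟩).le (by omega)
    refine (hstep.andThen fun s' ⟨hs', hpos', hbase'⟩ => terminatesIn_straight (by simp)
      ⟨hI base (by simp) _ _ _ (hI pos (by simp) _ _ _ hs'), ?_, ?_⟩).le
      (by simp only [Cmd.size]; omega)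
    · simp [hpos', (hgrid _ s' hs').width, Nat.succ_mul]
    · simp [hbase', (hgrid _ s' hs').degree, Nat.succ_mul]
  · rintro s ⟨hs, hpos, -⟩
    simpa [hpos, (hgrid _ s hs).size] using le_ceilDiv_mul n hw
  · rw [← List.countP_eq_length_filter, ← Nat.count, Nat.count_eq_card_filter_range]
    simp only [Finset.sum_add_distrib, Finset.sum_ite, Finset.sum_const, Finset.card_range,
      smul_eq_mul, Cmd.size]
    omega

theorem askIntervals_spec (h : Grid n d σ w s₀) (hw : 0 < w) (hbatch : s₀.batch = []) :
    TerminatesIn O (forIntervals askInterval) s₀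
      (7 * (n ⌈/⌉ w) + (unknownIntervals (s₀.nat known) w (n ⌈/⌉ w)).length * (6 * d + 3) + 5)
      (Agrees [pos, base, diffOrder]
        { s₀ with
          batch := (unknownIntervals (s₀.nat known) w (n ⌈/⌉ w)).flatMap (questions d σ w) }) := by
  let asking (i : ℕ) : State :=
    { s₀ with batch := (unknownIntervals (s₀.nat known) w i).flatMap (questions d σ w) }
  have hasking : ∀ i s, Agrees [pos, base, diffOrder] (asking i) s → Grid n d σ w s :=
    fun i s hA => Grid.agrees (s₀ := asking i) ⟨h.1, h.2, h.3, h.4⟩ hA (by simp)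
  refine (forIntervals_spec (t := 6 * d + 3) hw
    (fun i => Agrees [pos, base, diffOrder] (asking i)) (fun i => s₀.nat known (i * w) = 0)
    ⟨fun _ _ => rfl, rfl, hbatch, rfl, rfl⟩
    (fun a ha v _ _ hA => hA.writeN (by simp at ha ⊢; tauto) 0 v) hasking
    (fun i _ s hA => by rw [hA.nat known (by simp)]) ?_ ?_)
  · intro i _ hk s hA hpos hbase
    refine (askInterval_spec (hasking i s hA) hpos hbase).mono le_rfl fun s' hA' => ⟨?_, ?_, ?_⟩
    · have hA'' := (hA.append (questions d σ w i)).trans (hA'.mono (by simp))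
      simpa [asking, unknownIntervals, List.range_succ, hk] using hA''
    · simp [hA'.nat pos (by simp), hpos]
    · simp [hA'.nat base (by simp), hbase]
  · intro i _ hk s hA
    simpa [asking, unknownIntervals, List.range_succ, hk] using hA

theorem askAll_spec (h : Grid n d σ w s₀) (hw : 0 < w) (hbatch : s₀.batch = []) {c : ℕ}
    (hc : (unknownIntervals (s₀.nat known) w (n ⌈/⌉ w)).length = c) :
    TerminatesIn O (forIntervals askInterval ⨾ .submit) s₀
      (7 * (n ⌈/⌉ w) + c * (6 * d + 3) + 7) fun s =>
        Agrees [pos, base, diffOrder, leftAnswers, rightAnswers]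
          { s₀ with queries := s₀.queries + c * (d * 2), rounds := s₀.rounds + 1 } s ∧
        ∀ i < n ⌈/⌉ w, s₀.nat known (i * w) = 0 →
          Answered O d σ w (s.nat leftAnswers) (s.nat rightAnswers) i := by
  refine ((askIntervals_spec h hw hbatch).andThen fun s hA => terminatesIn_submit
    ⟨⟨fun a ha => ?_, ?_, ?_, ?_, ?_⟩, fun i hi hk => ?_⟩).le (by rw [hc]; omega)
  all_goals simp only [send_eq, hA.batch]
  · simp only [List.mem_cons, List.not_mem_nil, or_false, not_or] at ha
    rw [answerRow_of_forall_arr_ne, hA.nat a (by simp; tauto)]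
    intro q hq
    obtain ⟨i, -, hq⟩ := List.mem_flatMap.1 hq
    obtain ⟨k, -, rfl | rfl⟩ := mem_questions.1 hq <;> tauto
  · exact hA.real
  · exact hbatch.symm
  · rw [length_flatMap_questions, hc, hA.queries]
  · rw [hA.rounds]
  · exact answered_of_batch (by simpa [unknownIntervals, hi] using hk) _ _

theorem compareEnds_spec (h : Grid n d σ w s₀) (hbase : s₀.nat base 0 = i * d)
    (hans : Answered O d σ w (s₀.nat leftAnswers) (s₀.nat rightAnswers) i) :
    TerminatesIn O compareEnds s₀ (6 * d + 5) fun s =>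
      Agrees [diffOrder, differs] s₀ s ∧
        (s.nat differs 0 = 0 ↔ SameAnswers O d (σ (i * w)) (σ (i * w + w))) := by
  refine (TerminatesIn.seq (terminatesIn_straight (by simp) (TerminatesIn.countTo
    (fun k s => Agrees [diffOrder, differs] s₀ s ∧
      (s.nat differs 0 = 0 ↔ ∀ k' < k, O k' (σ (i * w)) = O k' (σ (i * w + w))))
    (by simp) d.zero_le (by simp) ⟨(Agrees.refl _ _).exec (by simp), by simp⟩
    ?_ ?_))).le (by simp only [Cmd.size]; omega)
  · rintro k s ⟨hA, -⟩
    simp [hA.nat input (by simp), h.degree]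
  · rintro k hk - s hs ⟨hA, hsame⟩
    have hb : (s.nat leftAnswers (i * d + k) ≤ s.nat rightAnswers (i * d + k) ∧
        s.nat rightAnswers (i * d + k) ≤ s.nat leftAnswers (i * d + k)) ↔
        O k (σ (i * w)) = O k (σ (i * w + w)) := by
      rw [hA.nat leftAnswers (by simp), hA.nat rightAnswers (by simp), (hans k hk).1,
        (hans k hk).2, le_antisymm_iff]
    refine ⟨?_, (hA.exec (by simp)).writeN (by simp) _ _, ?_⟩
    all_goals simp only [Cmd.exec, BExp.holds, NExp.eval, hA.nat base (by simp), hbase, hs, hb]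
    · split_ifs <;> simpa
    · rw [Nat.forall_lt_succ_right, ← hsame]
      split_ifs with hk <;> simp [hk]

open Classical in
theorem labelInterval_spec (h : Grid n d σ w s₀) {j : ℕ} (hpos : s₀.nat pos 0 = j) :
    TerminatesIn O labelInterval s₀ (6 * w + 3) fun s =>
      Agrees [labels, known, cursor] s₀ s ∧
        s.nat known = (Ico j (j + w)).piecewise (fun _ => 1) (s₀.nat known) ∧
        s.nat labels = (σ '' Ico j (j + w)).piecewise
          (fun _ => s₀.nat leftAnswers (s₀.nat base 0)) (s₀.nat labels) := by
  refine (TerminatesIn.seq (terminatesIn_setN (TerminatesIn.countTo (fun c s =>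
    Agrees [labels, known, cursor] s₀ s ∧
      s.nat known = (Ico j c).piecewise (fun _ => 1) (s₀.nat known) ∧
      s.nat labels = (σ '' Ico j c).piecewise
        (fun _ => s₀.nat leftAnswers (s₀.nat base 0)) (s₀.nat labels))
    (by simp) (Nat.le_add_right j w) (by simp [hpos]) ?_ ?_ ?_))).le
    (by simp only [Cmd.size]; omega)
  · refine ⟨(Agrees.refl _ _).writeN (by simp) _ _, ?_, ?_⟩ <;> ext <;> simp [piecewise]
  · rintro c s ⟨hA, -⟩
    simp [hA.nat pos (by simp), hpos, hA.nat width (by simp), h.width]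
  · rintro c - hjc s hs ⟨hA, hknown, hlabels⟩
    have hIco : Ico j (c + 1) = insert c (Ico j c) := by ext; simp; omega
    refine ⟨by simpa, (hA.exec (by simp)).writeN (by simp) _ _, ?_, ?_⟩
    · ext p
      by_cases hp : p = c <;> simp [piecewise, hIco, hknown, hp, hs]
    · ext v
      by_cases hv : v = σ c <;>
        simp [piecewise, hIco, image_insert_eq, hlabels, hv, hs, hA.nat order (by simp), h.order,
          hA.nat leftAnswers (by simp), hA.nat base (by simp)]

theorem resolveInterval_spec (h : Grid n d σ w s₀) (hd : 0 < d) (hw : 0 < w)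
    (hinf : Inferable O n d σ) (hpos : s₀.nat pos 0 = i * w) (hbase : s₀.nat base 0 = i * d)
    (hans : Answered O d σ w (s₀.nat leftAnswers) (s₀.nat rightAnswers) i)
    (hs₀ : Searched O n d σ w i (s₀.nat known) (s₀.nat labels)) :
    TerminatesIn O resolveInterval s₀ (6 * d + 6 * w + 10) fun s =>
      Agrees [labels, known, diffOrder, differs, cursor] s₀ s ∧
        EqOn (s.nat known) (s₀.nat known) (Ici (i * w + w)) ∧
        Searched O n d σ w (i + 1) (s.nat known) (s.nat labels) := by
  refine ((compareEnds_spec h hbase hans).andThen fun s ⟨hA, hsame⟩ =>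
    TerminatesIn.ite (t := 6 * w + 3) (fun hb => ?_) fun hb => ?_).le (by omega)
  all_goals
    have hG := h.agrees hA (by simp)
    have hpos' : s.nat pos 0 = i * w := by rw [hA.nat pos (by simp), hpos]
    have hdecided : ¬ (¬ w ≤ 1 ∧ ¬ (s.nat differs 0 ≤ 0 ∧ ¬ n ≤ i * w + w)) ↔
        Decided O n d σ w i := by
      rw [Nat.le_zero, hsame, Decided, ← not_le (a := n)]; tauto
    simp only [BExp.holds, NExp.eval, hG.width, hG.size, hpos', hdecided] at hb
  · refine (labelInterval_spec hG hpos').mono le_rfl fun s' ⟨hA', hknown, hlabels⟩ =>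
      ⟨(hA.mono (by simp)).trans (hA'.mono (by simp)), ?_, ?_⟩
    · intro p hp
      rw [hknown, piecewise_eq_of_notMem _ _ _ fun hblock => hblock.2.not_ge hp,
        hA.nat known (by simp)]
    · have hleft : s.nat leftAnswers (s.nat base 0) = O 0 (σ (i * w)) := by
        rw [hA.nat leftAnswers (by simp), hA.nat base (by simp), hbase]
        exact (hans 0 hd).1
      rw [hknown, hlabels, hleft, hA.nat known (by simp), hA.nat labels (by simp)]
      exact hs₀.mark_interval hw hinf hb
  · refine (terminatesIn_skip ⟨hA.mono (by simp), ?_, ?_⟩).le (by omega)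
    · rw [hA.nat known (by simp)]
      exact eqOn_refl _ _
    · rw [hA.nat known (by simp), hA.nat labels (by simp)]
      exact hs₀.succ fun _ => hb

theorem resolveIntervals_spec (h : Grid n d σ w s₀) (hd : 0 < d) (hw : 0 < w)
    (hinf : Inferable O n d σ)
    (hans : ∀ i < n ⌈/⌉ w, s₀.nat known (i * w) = 0 →
      Answered O d σ w (s₀.nat leftAnswers) (s₀.nat rightAnswers) i)
    (hs₀ : Searched O n d σ w 0 (s₀.nat known) (s₀.nat labels)) :
    TerminatesIn O (forIntervals resolveInterval) s₀
      (7 * (n ⌈/⌉ w) + (unknownIntervals (s₀.nat known) w (n ⌈/⌉ w)).length *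
        (6 * d + 6 * w + 10) + 5) fun s =>
      Agrees [pos, base, labels, known, diffOrder, differs, cursor] s₀ s ∧
        Searched O n d σ w (n ⌈/⌉ w) (s.nat known) (s.nat labels) := by
  refine (forIntervals_spec hw (fun i s =>
    Agrees [pos, base, labels, known, diffOrder, differs, cursor] s₀ s ∧
      EqOn (s.nat known) (s₀.nat known) (Ici (i * w)) ∧
      Searched O n d σ w i (s.nat known) (s.nat labels))
    (fun i => s₀.nat known (i * w) = 0) ⟨.refl _ _, eqOn_refl _ _, hs₀⟩ ?_
    (fun i s hs => h.agrees hs.1 (by simp))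
    (fun i _ s hs => by rw [hs.2.1 self_mem_Ici]) ?_ ?_).mono le_rfl fun s hs => ⟨hs.1, hs.2.2⟩
  · rintro a ha v i s ⟨hA, hs⟩
    refine ⟨hA.writeN (by simp at ha ⊢; tauto) _ _, ?_⟩
    have hne : known ≠ a ∧ labels ≠ a := by constructor <;> rintro rfl <;> simp at ha
    rwa [writeN_nat_of_ne _ _ _ hne.1, writeN_nat_of_ne _ _ _ hne.2]
  · rintro i hi hk s ⟨hA, hknown, hs⟩ hpos hbase
    have hans' := hans i hi hk
    rw [← hA.nat leftAnswers (by simp), ← hA.nat rightAnswers (by simp)] at hans'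
    refine (resolveInterval_spec (h.agrees hA (by simp)) hd hw hinf hpos hbase hans' hs).mono
      le_rfl fun s' ⟨hA', hknown', hs'⟩ => ⟨⟨hA.trans (hA'.mono (by simp)), ?_, hs'⟩, ?_, ?_⟩
    · rw [Nat.succ_mul]
      exact hknown'.trans (hknown.mono (Ici_subset_Ici.2 (Nat.le_add_right _ _)))
    · rw [hA'.nat pos (by simp), hpos]
    · rw [hA'.nat base (by simp), hbase]
  · rintro i - hk s ⟨hA, hknown, hs⟩
    refine ⟨hA, hknown.mono (Ici_subset_Ici.2 (by simp [Nat.succ_mul])), hs.succ fun hk' => ?_⟩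
    rw [hknown self_mem_Ici] at hk'
    exact absurd hk' hk

theorem refineGrid_spec {e κ : ℕ} (hn : s₀.nat input 0 = n) (hdeg : s₀.nat input 1 = d)
    (he : s₀.nat level 0 = e) (hκ : s₀.nat stride 0 = κ)
    (hpow : s₀.nat power (e - κ) = 2 ^ (e - κ)) :
    TerminatesIn O refineGrid s₀ 3 fun s => Agrees [level, Reg.width] s₀ s ∧
      s.nat level 0 = e - κ ∧ Grid n d (s₀.nat order) (2 ^ (e - κ)) s := by
  exact terminatesIn_straight (p := refineGrid) (by simp [refineGrid])
    ⟨(Agrees.refl _ _).exec (by simp [refineGrid]), by simp [refineGrid, he, hκ],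
      by simpa [refineGrid], by simpa [refineGrid], by simp [refineGrid, writeN_nat_of_ne],
      by simpa [refineGrid, he, hκ]⟩

theorem askAndResolve_spec (h : Grid n d σ w s₀) (hd : 0 < d) (hw : 0 < w)
    (hinf : Inferable O n d σ) (hbatch : s₀.batch = []) {c : ℕ}
    (hc : (unknownIntervals (s₀.nat known) w (n ⌈/⌉ w)).length = c)
    (hs₀ : Searched O n d σ w 0 (s₀.nat known) (s₀.nat labels)) :
    TerminatesIn O ((forIntervals askInterval ⨾ .submit) ⨾ forIntervals resolveInterval) s₀
      (14 * (n ⌈/⌉ w) + c * (12 * d + 6 * w + 13) + 13) fun s =>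
        Agrees [pos, base, diffOrder, leftAnswers, rightAnswers, labels, known, differs, cursor]
          { s₀ with queries := s₀.queries + c * (d * 2), rounds := s₀.rounds + 1 } s ∧
        Searched O n d σ w (n ⌈/⌉ w) (s.nat known) (s.nat labels) := by
  refine ((askAll_spec h hw hbatch hc).andThen
    (u := 7 * (n ⌈/⌉ w) + c * (6 * d + 6 * w + 10) + 5) fun s ⟨hA, hans⟩ =>
    (resolveIntervals_spec (Grid.agrees (A := [pos, base, diffOrder, leftAnswers, rightAnswers])
      (s₀ := { s₀ with queries := s₀.queries + c * (d * 2), rounds := s₀.rounds + 1 })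
      ⟨h.1, h.2, h.3, h.4⟩ hA (by simp)) hd hw hinf ?_ ?_).mono ?_ fun s' ⟨hA', hs'⟩ =>
        ⟨(hA.mono (by simp)).trans (hA'.mono (by simp)), hs'⟩).le (by linarith)
  · rwa [hA.nat known (by simp)]
  · rwa [hA.nat known (by simp), hA.nat labels (by simp)]
  · rw [hA.nat known (by simp), hc]

theorem askAndResolve_cost_le {m c : ℕ} (hw : 0 < w) (hwn : w < n) (hm : m * w ≤ n + w)
    (hcm : c ≤ m) (hcd : c * d ≤ 3 * n) :
    14 * m + c * (12 * d + 6 * w + 13) + 17 ≤ 119 * n := by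
  have hcw : c * w ≤ 2 * n := by nlinarith
  have hmw : m ≤ m * w := Nat.le_mul_of_pos_right m hw
  linarith

/-- The search with stride `κ` along the order `σ` has arrived at the grid of width `2 ^ e`. -/
structure Searching (O : ℕ → ℕ → ℕ) (n d κ : ℕ) (σ : ℕ → ℕ) (e : ℕ) (s : State) : Prop where
  size : s.nat input 0 = n
  degree : s.nat input 1 = d
  order : s.nat order = σ
  stride : s.nat stride 0 = κ
  power : ∀ i ≤ e, s.nat power i = 2 ^ i
  level : s.nat level 0 = e
  batch : s.batch = []
  searched : Searched O n d σ (2 ^ e) (n ⌈/⌉ 2 ^ e) (s.nat known) (s.nat labels)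

theorem two_pow_eq_mul (e κ : ℕ) : 2 ^ e = 2 ^ min e κ * 2 ^ (e - κ) := by
  rw [← pow_add, add_comm, Nat.sub_add_min_cancel]

theorem Searched.length_unknownIntervals_mul_le {e κ : ℕ} {mark label : ℕ → ℕ}
    (h : Searched O n d σ (2 ^ e) (n ⌈/⌉ 2 ^ e) mark label) (hfew : FewChanges O n d σ)
    (hd : 0 < d) :
    (unknownIntervals mark (2 ^ (e - κ)) (n ⌈/⌉ 2 ^ (e - κ))).length * d ≤
      3 * d ^ 3 * 2 ^ κ := by
  rw [two_pow_eq_mul e κ] at h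
  calc _ ≤ 2 ^ min e κ * (2 * d ^ 2 + 1) * d :=
        Nat.mul_le_mul_right d (h.length_unknownIntervals_le hfew (by positivity) (by positivity))
    _ ≤ 2 ^ κ * (2 * d ^ 2 + d ^ 2) * d := by
        gcongr
        · exact one_le_two
        · exact min_le_right _ _
        · exact Nat.one_le_pow _ _ hd
    _ = 3 * d ^ 3 * 2 ^ κ := by ring

theorem searchRound_spec {e κ : ℕ} (h : Searching O n d κ σ e s₀) (hlt : 2 ^ (e - κ) < n)
    (hd : 0 < d) (hsize : d ^ 3 * 2 ^ κ ≤ n) (hinf : Inferable O n d σ)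
    (hfew : FewChanges O n d σ) :
    TerminatesIn O searchRound s₀ (119 * n) fun s => Searching O n d κ σ (e - κ) s ∧
      s.queries ≤ s₀.queries + 6 * d ^ 3 * 2 ^ κ ∧ s.rounds = s₀.rounds + 1 := by
  obtain rfl := h.order
  have hw : 0 < 2 ^ (e - κ) := by positivity
  have hcd := h.searched.length_unknownIntervals_mul_le (κ := κ) hfew hd
  have hcm : (unknownIntervals (s₀.nat known) (2 ^ (e - κ)) (n ⌈/⌉ 2 ^ (e - κ))).length ≤
      n ⌈/⌉ 2 ^ (e - κ) := (List.length_filter_le _ _).trans (by simp)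
  generalize hc : (unknownIntervals (s₀.nat known) (2 ^ (e - κ)) (n ⌈/⌉ 2 ^ (e - κ))).length = c
    at hcd hcm
  have hcost := askAndResolve_cost_le (d := d) hw hlt (ceilDiv_mul_le n hw) hcm (by linarith)
  refine ((refineGrid_spec h.size h.degree h.level h.stride (h.power _ (e.sub_le κ))).andThen
    fun s ⟨hA, hlevel, hG⟩ => (askAndResolve_spec hG hd hw hinf (hA.batch.trans h.batch)
      (hA.nat known (by simp) ▸ hc) ?_).mono le_rfl
      fun s' ⟨hA', hs'⟩ => ?_).le (by linarith)
  · rw [hA.nat known (by simp), hA.nat labels (by simp)]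
    exact (two_pow_eq_mul e κ ▸ h.searched).refine hw
  · refine ⟨⟨?_, ?_, ?_, ?_, ?_, ?_, ?_, hs'⟩, ?_, ?_⟩
    · simp [hA'.nat, hA.nat, h.size]
    · simp [hA'.nat, hA.nat, h.degree]
    · simp [hA'.nat, hA.nat]
    · simp [hA'.nat, hA.nat, h.stride]
    · intro i hi
      simp [hA'.nat, hA.nat, h.power i (by omega)]
    · simp [hA'.nat, hlevel]
    · rw [hA'.batch, hA.batch, h.batch]
    · rw [hA'.queries, hA.queries]
      linarith
    · rw [hA'.rounds, hA.rounds]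

theorem search_spec {L κ : ℕ} (hn : s₀.nat input 0 = n) (hdeg : s₀.nat input 1 = d)
    (hbatch : s₀.batch = []) (hL : s₀.nat logSize 0 = L) (hκ : s₀.nat stride 0 = κ)
    (hpow : ∀ e ≤ L, s₀.nat power e = 2 ^ e) (hknown : s₀.nat known = fun _ => 0)
    (hlog : L = Nat.clog 2 n) (hn₁ : 1 < n) (hd : 0 < d) (hκ₀ : 0 < κ)
    (hsize : d ^ 3 * 2 ^ κ ≤ n) (hinf : Inferable O n d (s₀.nat order))
    (hfew : FewChanges O n d (s₀.nat order)) :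
    TerminatesIn O search s₀ ((L ⌈/⌉ κ) * (119 * n + 1) + 3) fun s =>
      (∀ p < n, s.nat labels (s₀.nat order p) = O 0 (s₀.nat order p)) ∧
      s.queries ≤ s₀.queries + (L ⌈/⌉ κ) * (6 * d ^ 3 * 2 ^ κ) ∧
      s.rounds = s₀.rounds + (L ⌈/⌉ κ) := by
  have hstart : Searching O n d κ (s₀.nat order) L (s₀.writeN level 0 L) := by
    refine ⟨by simpa, by simpa, by simp [writeN_nat_of_ne], by simpa, by simpa, by simp, hbatch, ?_⟩
    rw [writeN_nat_of_ne _ _ _ (by simp), hknown]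
    exact searched_zero (Nat.one_lt_two_pow (hlog ▸ Nat.clog_pos one_lt_two hn₁).ne')
      (hlog ▸ Nat.le_pow_clog one_lt_two n)
  refine (TerminatesIn.seq (terminatesIn_setN (TerminatesIn.loop_const
    (fun i s => Searching O n d κ (s₀.nat order) (L - i * κ) s ∧
      s.queries ≤ s₀.queries + i * (6 * d ^ 3 * 2 ^ κ) ∧ s.rounds = s₀.rounds + i)
    (L ⌈/⌉ κ) (119 * n) ?_ ?_ ?_ ?_))).mono (by omega) ?_
  · exact ⟨by simpa [hL] using hstart, Nat.le_add_right _ _, rfl⟩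
  · rintro i hi s ⟨hs, -⟩
    rw [lt_ceilDiv_iff hκ₀] at hi
    simp only [BExp.holds, NExp.eval, hs.level]
    omega
  · rintro i hi s ⟨hs, hq, hr⟩
    rw [lt_ceilDiv_iff hκ₀] at hi
    have hlt : 2 ^ (L - i * κ - κ) < n := (Nat.lt_clog_iff_pow_lt one_lt_two).1 (by omega)
    refine (searchRound_spec hs hlt hd hsize hinf hfew).mono le_rfl fun s' ⟨hs', hq', hr'⟩ =>
      ⟨?_, hq'.trans (by linarith), by rw [hr', hr, add_assoc]⟩
    rwa [Nat.succ_mul, ← Nat.sub_sub]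
  · rintro s ⟨hs, -⟩
    simp [hs.level, Nat.sub_eq_zero_of_le (le_ceilDiv_mul L hκ₀)]
  · rintro s ⟨hs, hq, hr⟩
    have hs' := hs.searched
    rw [Nat.sub_eq_zero_of_le (le_ceilDiv_mul L hκ₀), pow_zero, ceilDiv_one] at hs'
    exact ⟨fun p hp => hs'.label_eq hp, hq, hr⟩

end Search

/-! ### Signs of derivatives -/

section Signs

open Polynomial Set

variable {f : ℝ[X]} {a b y : ℝ}

theorem signBit_eq_signBit_iff : signBit a = signBit b ↔ (0 ≤ a ↔ 0 ≤ b) := by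
  unfold signBit
  split_ifs with ha hb hb <;> simp [ha, hb]

theorem monotoneOn_or_antitoneOn_of_signBit_derivative
    (h : ∀ y ∈ Icc a b, signBit ((derivative f).eval y) = signBit ((derivative f).eval a)) :
    MonotoneOn (fun y => f.eval y) (Icc a b) ∨ AntitoneOn (fun y => f.eval y) (Icc a b) := by
  simp only [signBit_eq_signBit_iff] at h
  rcases le_or_gt 0 ((derivative f).eval a) with ha | ha
  · refine .inl (monotoneOn_of_deriv_nonneg (convex_Icc a b) f.continuousOn
      f.differentiable.differentiableOn fun y hy => ?_)
    rw [Polynomial.deriv]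
    exact (h y (interior_subset hy)).2 ha
  · refine .inr (antitoneOn_of_deriv_nonpos (convex_Icc a b) f.continuousOn
      f.differentiable.differentiableOn fun y hy => ?_)
    rw [Polynomial.deriv]
    exact (not_le.1 fun hpos => ha.not_ge ((h y (interior_subset hy)).1 hpos)).le

theorem signBit_eval_eq_of_derivatives {d : ℕ} (hf : f.natDegree ≤ d)
    (h : ∀ k < d, signBit ((derivative^[k] f).eval a) = signBit ((derivative^[k] f).eval b))
    (hy : y ∈ Icc a b) : signBit (f.eval y) = signBit (f.eval a) := by
  induction d generalizing f y with
  | zero => rw [eq_C_of_natDegree_eq_zero (Nat.le_zero.1 hf), eval_C, eval_C]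
  | succ d ih =>
    have hends := signBit_eq_signBit_iff.1 (h 0 d.succ_pos)
    have ha : a ∈ Icc a b := left_mem_Icc.2 (hy.1.trans hy.2)
    have hb : b ∈ Icc a b := right_mem_Icc.2 (hy.1.trans hy.2)
    rw [signBit_eq_signBit_iff]
    rcases monotoneOn_or_antitoneOn_of_signBit_derivative fun y hy =>
      ih ((natDegree_derivative_le f).trans (by omega))
        (fun k hk => h (k + 1) (by omega)) hy with hm | hm
    · exact ⟨fun h₁ => hends.2 (h₁.trans (hm hy hb hy.2)), fun h₁ => h₁.trans (hm ha hy hy.1)⟩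
    · exact ⟨fun h₁ => h₁.trans (hm ha hy hy.1), fun h₁ => (hends.1 h₁).trans (hm hy hb hy.2)⟩

theorem exists_root_of_signBit_ne (hab : a ≤ b) (h : signBit (f.eval a) ≠ signBit (f.eval b)) :
    ∃ y ∈ Icc a b, f.IsRoot y := by
  rw [Ne, signBit_eq_signBit_iff] at h
  rcases le_or_gt 0 (f.eval a) with ha | ha <;> rcases le_or_gt 0 (f.eval b) with hb | hb
  · exact absurd (iff_of_true ha hb) h
  · exact intermediate_value_Icc' hab f.continuousOn ⟨hb.le, ha⟩
  · exact intermediate_value_Icc hab f.continuousOn ⟨ha.le, hb⟩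
  · exact absurd (iff_of_false ha.not_ge hb.not_ge) h

theorem card_le_two_of_not_between {ι : Type*} [LinearOrder ι] {s : Finset ι}
    (h : ∀ i ∈ s, ∀ j ∈ s, ∀ k ∈ s, i < j → ¬ j < k) : s.card ≤ 2 := by
  rcases s.eq_empty_or_nonempty with rfl | hs
  · simp
  · refine (Finset.card_le_card (t := {s.min' hs, s.max' hs}) fun i hi => ?_).trans
      Finset.card_le_two
    rw [Finset.mem_insert, Finset.mem_singleton, or_iff_not_imp_left]
    intro hne
    refine (s.le_max' i hi).antisymm (not_lt.1 ?_)
    exact h _ (s.min'_mem hs) i hi _ (s.max'_mem hs) ((s.min'_le i hi).lt_of_ne' hne)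

section Grid

variable {n : ℕ} {z : ℕ → ℝ}

-- Of three intervals of a grid that contain `y`, the middle one is degenerate.
open Classical in
theorem card_grid_intervals_containing_le_two (hz : MonotoneOn z (Iio n)) (w : ℕ) (y : ℝ) :
    ((Finset.range n).filter fun q => q * w + w < n ∧ z (q * w) < z (q * w + w) ∧
      y ∈ Icc (z (q * w)) (z (q * w + w))).card ≤ 2 := by
  have hle {p q : ℕ} (hpq : p < q) (hq : q * w + w < n) : z (p * w + w) ≤ z (q * w) := by
    have hmul : p * w + w ≤ q * w := by nlinarith
    exact hz (mem_Iio.2 (by omega)) (mem_Iio.2 (by omega)) hmul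
  refine card_le_two_of_not_between fun i hi j hj k hk hij hjk => ?_
  rw [Finset.mem_filter] at hi hj hk
  exact hj.2.2.1.not_ge (((hle hjk hk.2.1).trans hk.2.2.2.1).trans
    (hi.2.2.2.2.trans (hle hij hj.2.1)))

open Classical in
theorem card_signBit_ne_le {m : ℕ} (hf : f.natDegree ≤ m) (hz : MonotoneOn z (Iio n)) (w : ℕ) :
    ((Finset.range n).filter fun q => q * w + w < n ∧
      signBit (f.eval (z (q * w))) ≠ signBit (f.eval (z (q * w + w)))).card ≤ 2 * m := by
  set changes := (Finset.range n).filter fun q => q * w + w < n ∧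
    signBit (f.eval (z (q * w))) ≠ signBit (f.eval (z (q * w + w)))
  have hchange {q : ℕ} (hq : q ∈ changes) := (Finset.mem_filter.1 hq).2
  have hle {q : ℕ} (hq : q ∈ changes) : z (q * w) ≤ z (q * w + w) :=
    hz (mem_Iio.2 (by have := (hchange hq).1; omega)) (hchange hq).1 (Nat.le_add_right _ _)
  choose! root hmem hroot using fun q (hq : q ∈ changes) =>
    exists_root_of_signBit_ne (hle hq) (hchange hq).2
  refine (Finset.card_le_mul_card_image_of_maps_to (f := root) (t := f.roots.toFinset)
    (fun q hq => ?_) 2 fun y _ => ?_).trans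
    (Nat.mul_le_mul_left 2 (f.roots.toFinset_card_le.trans (f.card_roots'.trans hf)))
  · have hf₀ : f ≠ 0 := by
      rintro rfl
      exact (hchange hq).2 (by simp)
    rw [Multiset.mem_toFinset, mem_roots hf₀]
    exact hroot q hq
  · refine (Finset.card_le_card fun q hq => ?_).trans
      (card_grid_intervals_containing_le_two hz w y)
    rw [Finset.mem_filter] at hq ⊢
    obtain ⟨hq, rfl⟩ := hq
    exact ⟨(Finset.mem_filter.1 hq).1, (hchange hq).1,
      (hle hq).lt_of_ne fun h => (hchange hq).2 (by rw [h]), hmem q hq⟩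

end Grid

variable {n d : ℕ} {x : Fin n → ℝ} {X : ℕ → ℝ} {σ : ℕ → ℕ}

theorem derivOracle_of_lt (hX : ∀ i : Fin n, X i = x i) {k p : ℕ} (hk : k < d) (hp : p < n) :
    derivOracle d x f k p = signBit ((derivative^[k] f).eval (X p)) := by
  rw [derivOracle, dif_pos ⟨hk, hp⟩, hX ⟨p, hp⟩]

theorem inferable_derivOracle (hf : f.natDegree ≤ d) (hd : 0 < d) (hX : ∀ i : Fin n, X i = x i)
    (hσ : MapsTo σ (Iio n) (Iio n)) (hmono : MonotoneOn (X ∘ σ) (Iio n)) :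
    Inferable (derivOracle d x f) n d σ := by
  intro a b hab hb hsame p hp
  have ha : a < n := by omega
  have hpn : p < n := hp.2.trans_lt hb
  have horacle {k q : ℕ} (hk : k < d) (hq : q < n) := derivOracle_of_lt (f := f) hX hk (hσ hq)
  rw [horacle hd hpn, horacle hd ha]
  refine signBit_eval_eq_of_derivatives (b := X (σ b)) hf (fun k hk => ?_)
    ⟨hmono ha hpn hp.1, hmono hpn hb hp.2⟩
  exact (horacle hk ha).symm.trans ((hsame k hk).trans (horacle hk hb))

theorem fewChanges_derivOracle (hf : f.natDegree ≤ d) (hX : ∀ i : Fin n, X i = x i)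
    (hσ : MapsTo σ (Iio n) (Iio n)) (hmono : MonotoneOn (X ∘ σ) (Iio n)) :
    FewChanges (derivOracle d x f) n d σ := by
  classical
  intro w
  calc _ ≤ ((Finset.range d).biUnion fun k => (Finset.range n).filter fun q => q * w + w < n ∧
        signBit ((derivative^[k] f).eval ((X ∘ σ) (q * w))) ≠
          signBit ((derivative^[k] f).eval ((X ∘ σ) (q * w + w)))).card := by
        refine Finset.card_le_card fun q hq => ?_
        obtain ⟨hq, hqn, hdiffer⟩ := Finset.mem_filter.1 hq
        simp only [SameAnswers, not_forall] at hdiffer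
        obtain ⟨k, hk, hne⟩ := hdiffer
        rw [derivOracle_of_lt hX hk (hσ (mem_Iio.2 (by omega))),
          derivOracle_of_lt hX hk (hσ hqn)] at hne
        rw [Finset.mem_biUnion]
        exact ⟨k, Finset.mem_range.2 hk, Finset.mem_filter.2 ⟨hq, hqn, hne⟩⟩
    _ ≤ (Finset.range d).card * (2 * d) :=
        Finset.card_biUnion_le_card_mul _ _ _ fun k _ => card_signBit_ne_le
          ((natDegree_iterate_derivative f k).trans ((Nat.sub_le _ _).trans hf)) hmono w
    _ = 2 * d ^ 2 := by rw [Finset.card_range]; ring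

end Signs

/-! ### The learner -/

section Learner

open Set

variable {O : ℕ → ℕ → ℕ} {n d κ t : ℕ} {α : ℝ} {x : Fin n → ℝ} {f : ℝ[X]} {s : State}

/-- The state after the preparation, in which `κ` is the logarithm of the branching factor. -/
structure Prepared (d κ : ℕ) (x : Fin n → ℝ) (s : State) : Prop where
  size : s.nat input 0 = n
  degree : s.nat input 1 = d
  point : ∀ i : Fin n, s.real 0 i = x i
  logSize : s.nat logSize 0 = Nat.clog 2 n
  stride : s.nat stride 0 = κ
  power : ∀ e ≤ Nat.clog 2 n, s.nat power e = 2 ^ e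
  blank : ∀ a ∉ [input, Reg.power, Reg.logSize, Reg.stride], s.nat a = fun _ => 0
  batch : s.batch = []
  queries : s.queries = 0
  rounds : s.rounds = 0

theorem preparation_spec {P : Cmd} :
    TerminatesIn O (powers ⨾ exponent) (init P d α x).state
      (4 * Nat.clog 2 n + 2 * ⌈α * Nat.clog 2 n⌉₊ + 5)
      (Prepared d ⌈α * Nat.clog 2 n⌉₊ x) := by
  refine ((powers_spec (n := n) (by simp [init]) (by simp [init])).andThen fun s ⟨hA, hlog, hpow⟩ =>
    (exponent_spec ?_).mono (u := 2 * ⌈α * Nat.clog 2 n⌉₊ + 1) ?_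
      fun s' ⟨hA', hstride⟩ => ?_).le (by omega)
  · simp [hA.nat, init]
  · simp [hA.real, hlog, init]
  · constructor
    · simp [hA'.nat, hA.nat, init]
    · simp [hA'.nat, hA.nat, init]
    · simp [hA'.real, hA.real, init]
    · simp [hA'.nat, hlog]
    · simp [hstride, hA.real, hlog, init]
    · simpa [hA'.nat] using hpow
    · intro a ha
      simp only [input, Reg.power, Reg.logSize, Reg.stride, List.mem_cons, not_or] at ha
      simp [hA'.nat, hA.nat, ha, init]
    · rw [hA'.batch, hA.batch]; rfl
    · rw [hA'.queries, hA.queries]; rfl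
    · rw [hA'.rounds, hA.rounds]; rfl

/-- The correct labels of all sample points have been found with at most `q` queries in at most `r`
rounds. -/
structure Labelled (x : Fin n → ℝ) (f : ℝ[X]) (q r : ℕ) (s : State) : Prop where
  label : ∀ j : Fin n, s.nat labels j = signBit (f.eval (x j))
  queries : s.queries ≤ q
  rounds : s.rounds ≤ r

theorem Prepared.search (h : Prepared d κ x s) (hf : f.natDegree ≤ d) (hn : 1 < n) (hd : 0 < d)
    (hκ : 0 < κ) (hsize : d ^ 3 * 2 ^ κ ≤ n) (ht : 1 ≤ t)
    (ht' : Monotone x ∨ Nat.clog 2 n * (70 * n + 1) < t) :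
    TerminatesIn (derivOracle d x f) (sort ⨾ search) s
      (8 * n + 7 + t + (Nat.clog 2 n ⌈/⌉ κ) * (119 * n + 1))
      (Labelled x f ((Nat.clog 2 n ⌈/⌉ κ) * (6 * d ^ 3 * 2 ^ κ)) (Nat.clog 2 n ⌈/⌉ κ)) := by
  have hsorted (hx : Monotone x) : MonotoneOn (s.real 0) (Iio n) := fun i hi j hj hij => by
    simpa only [h.point ⟨i, hi⟩, h.point ⟨j, hj⟩] using hx (Fin.mk_le_mk.2 hij)
  refine ((sort_spec h.size (by simp [h.blank]) (by simp [h.blank]) (by simp [h.blank])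
    h.logSize h.power ht (ht'.imp_left hsorted)).andThen
    fun s' ⟨hA, himage, hmono⟩ => (search_spec (by rw [hA.nat input (by simp), h.size])
      (by rw [hA.nat input (by simp), h.degree]) (hA.batch.trans h.batch)
      (by rw [hA.nat Reg.logSize (by simp), h.logSize])
      (by rw [hA.nat Reg.stride (by simp), h.stride])
      (by simpa [hA.nat] using h.power) (by rw [hA.nat known (by simp), h.blank _ (by simp)])
      rfl hn hd hκ hsize
      (inferable_derivOracle hf hd h.point (mapsTo_iff_image_subset.2 himage.subset) hmono)
      (fewChanges_derivOracle hf h.point (mapsTo_iff_image_subset.2 himage.subset) hmono)).mono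
      le_rfl fun s'' ⟨hlabel, hq, hr⟩ => ⟨fun j => ?_, ?_, ?_⟩).le (by omega)
  · obtain ⟨p, hp, hpj⟩ := himage.superset (mem_Iio.2 j.2)
    rw [← hpj, hlabel p hp, hpj, derivOracle_of_lt h.point hd j.2, h.point, Function.iterate_zero,
      id]
  · rwa [hA.queries, h.queries, zero_add] at hq
  · rw [hr, hA.rounds, h.rounds, zero_add]

theorem Prepared.queryAll (h : Prepared d κ x s) (hd : 0 < d) :
    TerminatesIn (derivOracle d x f) queryAll s (4 * n + 3) (Labelled x f n 1) := by
  refine (queryAll_spec h.size (by simp [h.blank]) h.batch).mono le_rfl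
    fun s' ⟨hlabel, hq, hr⟩ => ⟨fun j => ?_, ?_, ?_⟩
  · rw [hlabel j j.2, derivOracle_of_lt h.point hd j.2, h.point, Function.iterate_zero, id]
  · rw [hq, h.queries, zero_add]
  · rw [hr, h.rounds]

theorem Labelled.mono {q q' r r' : ℕ} (h : Labelled x f q r s) (hq : q ≤ q') (hr : r ≤ r') :
    Labelled x f q' r' s :=
  ⟨h.label, h.queries.trans hq, h.rounds.trans hr⟩

theorem Prepared.searchPays_iff (h : Prepared d κ x s) (hκ : κ ≤ Nat.clog 2 n) :
    BExp.searchPays.holds s ↔ d ^ 3 * 2 ^ κ ≤ n := by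
  simp only [BExp.searchPays, BExp.holds, RExp.eval, NExp.eval, h.size, h.degree, h.stride,
    h.power κ hκ]
  rw [pow_three', ← Nat.cast_le (α := ℝ)]
  push_cast
  rfl

theorem ceilDiv_le_self (L : ℕ) (hκ : 0 < κ) : L ⌈/⌉ κ ≤ L := by
  rw [ceilDiv_le_iff_le_mul hκ]
  exact Nat.le_mul_of_pos_left L hκ

theorem learner_spec (hf : f.natDegree ≤ d) (hn : 1 < n) (hd : 0 < d) (hα : 0 < α) (hα' : α ≤ 1)
    (hκ : κ = ⌈α * Nat.clog 2 n⌉₊) (ht : 1 ≤ t)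
    (ht' : Monotone x ∨ Nat.clog 2 n * (70 * n + 1) < t) :
    TerminatesIn (derivOracle d x f) learner (init learner d α x).state
      (22 * n + t + 119 * (n * (Nat.clog 2 n ⌈/⌉ κ)))
      (Labelled x f ((Nat.clog 2 n ⌈/⌉ κ) * (6 * d ^ 3 * 2 ^ κ)) (Nat.clog 2 n ⌈/⌉ κ)) := by
  have hL : 0 < Nat.clog 2 n := Nat.clog_pos one_lt_two hn
  have hLn : Nat.clog 2 n ≤ n :=
    (Nat.clog_le_iff_le_pow one_lt_two).2 Nat.lt_two_pow_self.le
  have hκ₀ : 0 < κ := hκ ▸ Nat.ceil_pos.2 (by positivity)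
  have hκL : κ ≤ Nat.clog 2 n :=
    hκ ▸ Nat.ceil_le.2 (mul_le_of_le_one_left (Nat.cast_nonneg _) hα')
  generalize hR : Nat.clog 2 n ⌈/⌉ κ = R
  have hR₀ : 0 < R := hR ▸ (lt_ceilDiv_iff hκ₀).2 (by omega)
  have hRn : R ≤ n := hR ▸ (ceilDiv_le_self _ hκ₀).trans hLn
  have hprepare : TerminatesIn (derivOracle d x f) (powers ⨾ exponent) (init learner d α x).state
      (4 * Nat.clog 2 n + 2 * κ + 5) (Prepared d κ x) := hκ ▸ preparation_spec
  refine (hprepare.andThen fun s h => TerminatesIn.ite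
    (t := 8 * n + 7 + t + R * (119 * n + 1)) (fun hb => ?_) fun hb => ?_).le ?_
  · exact hR ▸ h.search hf hn hd hκ₀ ((h.searchPays_iff hκL).1 hb) ht ht'
  · rw [h.searchPays_iff hκL, not_le] at hb
    refine (h.queryAll hd).mono (by omega) fun s' hs' => hs'.mono ?_ hR₀
    calc n ≤ R * (6 * (d ^ 3 * 2 ^ κ)) := by nlinarith
      _ = R * (6 * d ^ 3 * 2 ^ κ) := by ring
  · nlinarith

theorem natCast_clog_lt (hn : 0 < n) : (Nat.clog 2 n : ℝ) < Real.logb 2 n + 1 := by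
  have hlt := Nat.ceil_lt_add_one (Real.logb_nonneg one_lt_two (Nat.one_le_cast.2 hn))
  rwa [← Nat.cast_ofNat (n := 2), Real.natCeil_logb_natCast] at hlt

theorem natCast_clog_le (hn : 1 < n) : (Nat.clog 2 n : ℝ) ≤ 2 * Real.logb 2 n := by
  have hlog : 1 ≤ Real.logb 2 n := by
    rw [Real.le_logb_iff_rpow_le one_lt_two (by positivity), Real.rpow_one]
    exact_mod_cast hn
  linarith [natCast_clog_lt (Nat.zero_lt_of_lt hn)]

theorem two_pow_ceil_le (hn : 0 < n) (hα : 0 ≤ α) (hα' : α ≤ 1) :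
    (2 : ℝ) ^ ⌈α * Nat.clog 2 n⌉₊ ≤ 4 * (n : ℝ) ^ α := by
  have hceil := Nat.ceil_lt_add_one (a := α * Nat.clog 2 n) (by positivity)
  calc (2 : ℝ) ^ ⌈α * Nat.clog 2 n⌉₊ = 2 ^ (⌈α * Nat.clog 2 n⌉₊ : ℝ) := (Real.rpow_natCast _ _).symm
    _ ≤ 2 ^ (Real.logb 2 n * α + 2) :=
        Real.rpow_le_rpow_of_exponent_le one_le_two (by nlinarith [natCast_clog_lt hn])
    _ = 4 * (n : ℝ) ^ α := by
        rw [Real.rpow_add two_pos, Real.rpow_mul zero_le_two,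
          Real.rpow_logb two_pos (by norm_num) (Nat.cast_pos.2 hn), Real.rpow_two]
        ring

theorem ceilDiv_ceil_le (hα : 0 < α) {L : ℕ} (hL : 0 < L) :
    ((L ⌈/⌉ ⌈α * L⌉₊ : ℕ) : ℝ) ≤ 1 + 1 / α := by
  have hpos : 0 < ⌈α * L⌉₊ := Nat.ceil_pos.2 (by positivity)
  refine le_of_mul_le_mul_right ?_ (Nat.cast_pos.2 hpos)
  calc ((L ⌈/⌉ ⌈α * L⌉₊ : ℕ) : ℝ) * ⌈α * L⌉₊ ≤ L + ⌈α * L⌉₊ := by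
        exact_mod_cast ceilDiv_mul_le L hpos
    _ = 1 / α * (α * L) + ⌈α * L⌉₊ := by rw [← mul_assoc, one_div_mul_cancel hα.ne', one_mul]
    _ ≤ 1 / α * ⌈α * L⌉₊ + ⌈α * L⌉₊ := by gcongr; exact Nat.le_ceil _
    _ = (1 + 1 / α) * ⌈α * L⌉₊ := by ring

theorem queryBound_le (hn : 1 < n) (hα : 0 < α) (hα' : α ≤ 1) (d : ℕ) :
    ((Nat.clog 2 n ⌈/⌉ ⌈α * Nat.clog 2 n⌉₊ : ℕ) : ℝ) * (6 * d ^ 3 * 2 ^ ⌈α * Nat.clog 2 n⌉₊) ≤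
      48 * (d ^ 3 * n ^ α / α) := by
  have hone : 1 ≤ 1 / α := (one_le_div hα).2 hα'
  calc _ ≤ 2 * (1 / α) * (6 * d ^ 3 * (4 * (n : ℝ) ^ α)) := by
        gcongr
        · exact (ceilDiv_ceil_le hα (Nat.clog_pos one_lt_two hn)).trans (by linarith)
        · exact two_pow_ceil_le (by omega) hα.le hα'
    _ = 48 * (d ^ 3 * n ^ α / α) := by ring

theorem timeBound_le_of_sorted (hn : 1 < n) (hα : 0 < α) (hα' : α ≤ 1) :
    22 * n + 1 + 119 * (n * ((Nat.clog 2 n ⌈/⌉ ⌈α * Nat.clog 2 n⌉₊ : ℕ) : ℝ)) ≤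
      261 * (n / α) := by
  have hn' : (1 : ℝ) ≤ n := by exact_mod_cast hn.le
  have hone : 1 ≤ 1 / α := (one_le_div hα).2 hα'
  calc _ ≤ 23 * n * (1 / α) + 119 * (n * (2 * (1 / α))) := by
        gcongr
        · nlinarith
        · exact (ceilDiv_ceil_le hα (Nat.clog_pos one_lt_two hn)).trans (by linarith)
    _ = 261 * (n / α) := by ring

theorem timeBound_le (hn : 1 < n) (hκ : 0 < κ) :
    22 * n + (Nat.clog 2 n * (70 * n + 1) + 1) + 119 * (n * ((Nat.clog 2 n ⌈/⌉ κ : ℕ) : ℝ)) ≤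
      426 * (n * Real.logb 2 n) := by
  have hn' : (1 : ℝ) ≤ n := by exact_mod_cast hn.le
  have hL : (1 : ℝ) ≤ Nat.clog 2 n := by exact_mod_cast Nat.clog_pos one_lt_two hn
  have hnL : (n : ℝ) ≤ n * Nat.clog 2 n := le_mul_of_one_le_right (by positivity) hL
  have hLn : (Nat.clog 2 n : ℝ) ≤ n * Nat.clog 2 n := le_mul_of_one_le_left (by positivity) hn'
  have hR : (n : ℝ) * (Nat.clog 2 n ⌈/⌉ κ : ℕ) ≤ n * Nat.clog 2 n := by
    gcongr
    exact ceilDiv_le_self _ hκ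
  calc _ ≤ 213 * (n * Nat.clog 2 n : ℝ) := by linarith
    _ ≤ 213 * (n * (2 * Real.logb 2 n)) := by gcongr; exact natCast_clog_le hn
    _ = 426 * (n * Real.logb 2 n) := by ring

end Learner

end RealRAM

theorem mainTheorem2_general :
    ∃ (P : RealRAM.Cmd) (C : ℝ), ∀ (d n : ℕ) (α : ℝ), 1 ≤ d → 2 ≤ n → 0 < α → α ≤ 1 →
      ∀ (x : Fin n → ℝ) (f : Polynomial ℝ), f.natDegree ≤ d →
        RealRAM.LabelsPerfectly P d α x f ∧
        RealRAM.expectedCost RealRAM.State.queries P d α x f ≤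
          ENNReal.ofReal (C * ((d : ℝ) ^ 3 * (n : ℝ) ^ α / α)) ∧
        RealRAM.expectedCost RealRAM.State.rounds P d α x f ≤ ENNReal.ofReal (1 + 2 / α) ∧
        RealRAM.expectedCost RealRAM.State.time P d α x f ≤
          ENNReal.ofReal (C * (n * Real.logb 2 n)) ∧
        (Monotone x →
          RealRAM.expectedCost RealRAM.State.time P d α x f ≤ ENNReal.ofReal (C * (n / α))) := by
  refine ⟨RealRAM.learner, 426, fun d n α hd hn hα hα' x f hf => ?_⟩
  have hL : 0 < Nat.clog 2 n := Nat.clog_pos one_lt_two hn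
  have hspec (t : ℕ) := RealRAM.learner_spec (t := t) (x := x) hf hn hd hα hα' rfl
  have h := hspec (Nat.clog 2 n * (70 * n + 1) + 1) (by omega) (.inr (by omega))
  refine ⟨h.labelsPerfectly fun s hs => hs.label,
    h.expectedCost_le RealRAM.neverDecreases_queries fun s _ _ hs =>
      (Nat.cast_le.2 hs.queries).trans ?_,
    h.expectedCost_le RealRAM.neverDecreases_rounds fun s _ _ hs =>
      (Nat.cast_le.2 hs.rounds).trans ?_,
    h.expectedCost_le RealRAM.neverDecreases_time fun s _ ht _ =>
      (Nat.cast_le.2 ht).trans ?_,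
    fun hx => (hspec 1 le_rfl (.inl hx)).expectedCost_le RealRAM.neverDecreases_time
      fun s _ ht _ => (Nat.cast_le.2 ht).trans ?_⟩
  all_goals push_cast
  · exact (RealRAM.queryBound_le hn hα hα' d).trans (by gcongr; norm_num)
  · exact (RealRAM.ceilDiv_ceil_le hα hL).trans (by gcongr; norm_num)
  · exact RealRAM.timeBound_le hn (Nat.ceil_pos.2 (by positivity))
  · exact (RealRAM.timeBound_le_of_sorted hn hα hα').trans (by gcongr; norm_num)

theorem mainTheorem2 :
    ∃ (P : RealRAM.Cmd) (C : ℝ), ∀ (d n : ℕ) (α : ℝ), 1 ≤ d → 2 ≤ n →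
      1 / Real.logb 2 n < α → α ≤ 1 →
      ∀ x : Fin n → ℝ, Function.Injective x → ∀ f : Polynomial ℝ, f.natDegree ≤ d →
        RealRAM.LabelsPerfectly P d α x f ∧
        RealRAM.expectedCost RealRAM.State.queries P d α x f ≤
          ENNReal.ofReal (C * ((d : ℝ) ^ 3 * (n : ℝ) ^ α / α)) ∧
        RealRAM.expectedCost RealRAM.State.rounds P d α x f ≤ ENNReal.ofReal (1 + 2 / α) ∧
        RealRAM.expectedCost RealRAM.State.time P d α x f ≤
          ENNReal.ofReal (C * (n * Real.logb 2 n)) ∧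
        (StrictMono x →
          RealRAM.expectedCost RealRAM.State.time P d α x f ≤ ENNReal.ofReal (C * (n / α))) := by
  obtain ⟨P, C, h⟩ := mainTheorem2_general
  refine ⟨P, C, fun d n α hd hn hα hα' x _ f hf => ?_⟩
  have hlog : 0 ≤ Real.logb 2 n := Real.logb_nonneg one_lt_two (Nat.one_le_cast.2 (by omega))
  obtain ⟨hlabel, hquery, hround, htime, hsorted⟩ :=
    h d n α hd hn ((one_div_nonneg.2 hlog).trans_lt hα) hα' x f hf
  exact ⟨hlabel, hquery, hround, htime, fun hx => hsorted hx.monotone⟩
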